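/- Fix a horizon $T\ge 1$, dimensions $n\ge 1$, $m$, $p$, and the linear time-varying system $x_{k+1}=A_kx_k+B_ku_k+E_kw_k$ ($x_k\in\mathbb R^n$, $u_k\in\mathbb R^m$, $w_k\in\mathbb R^p$, $0\le k\le T-1$), where every $E_k$ has full row rank, with cost $J=\sum_{k=0}^{T}x_k^\top Q_kx_k+u_k^\top R_ku_k$, $Q_k\succeq 0$, $R_k\succ 0$, and a known initial state $x_0$. Let $\mathbf x=(x_0,\dots,x_T)$, $\mathbf u=(u_0,\dots,u_T)$, $\mathbf w=(w_0,\dots,w_{T-1})$, $\delta=(x_0,\mathbf w)$, let $J(\delta,\mathbf u)$ be the cost incurred by $\mathbf u$ and $J^*(\delta)=\min_{\tilde{\mathbf u}}J(\delta,\tilde{\mathbf u})$ the optimal non-causal cost. Let $\mathcal W_w\succ 0$ be a disturbance weight on $\delta$, let $P\succ 0$, $\mathbb W=\{w\in\mathbb R^p: w^\top Pw\le 1\}$. Put $\mathcal A=\mathrm{blkdiag}(A_0,\dots,A_T)$, $\mathcal B=\mathrm{blkdiag}(B_0,\dots,B_T)$ (with arbitrary $A_T,B_T$, which play no role), $\mathcal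 E=\mathrm{blkdiag}(\mathcal I,E_0,\dots,E_{T-1})$, $\mathcal Q=\mathrm{blkdiag}(Q_k)$, $\mathcal R=\mathrm{blkdiag}(R_k)$, $\mathcal C=\mathrm{blkdiag}(\mathcal Q,\mathcal R)$, let $\mathcal Z$ be the block downshift, $F=(\mathcal I-\mathcal Z\mathcal A)^{-1}\mathcal Z\mathcal B$, $G=(\mathcal I-\mathcal Z\mathcal A)^{-1}\mathcal E$ (so that $\mathbf x=F\mathbf u+G\delta$) and $\mathcal O=G^\top\mathcal Q(\mathcal I+F\mathcal R^{-1}F^\top\mathcal Q)^{-1}G$. Write $\mathcal O=\begin{bmatrix}\mathcal O_1&\mathcal O_2^\top\\ \mathcal O_2&\mathcal O_3\end{bmatrix}$, $\mathcal W_w=\begin{bmatrix}\mathcal W_1&\mathcal W_2^\top\\ \mathcal W_2&\mathcal W_3\end{bmatrix}$ according to $\delta=(x_0,\mathbf w)$, and let $\mathcal P_i$ be the block diagonal matrix with $P$ as its $i$-th block and $0$ elsewhere. A system response is a matrix $\Phi=\begin{bmatrix}\Phi_x\\ \Phi_u\end{bmatrix}=[\Phi_0\ \Phi_w]$ with $[\mathcal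 I-\mathcal Z\mathcal A\;\; -\mathcal Z\mathcal B]\,\Phi=\mathcal E$ that is causal, i.e. its block rows for $x_k$ and $u_k$ vanish on the columns of $w_k,\dots,w_{T-1}$. Let $\bar\mu^*$ be the optimal value of the SDP that minimises $\bar\mu$ over $\bar\mu\in\mathbb R$, $\bar\lambda_1,\dots,\bar\lambda_T\ge 0$ and system responses $\bar\Phi$ subject to $$\begin{bmatrix} x_0^\top(\mathcal O_1+\bar\mu\mathcal W_1)x_0-\sum_i\bar\lambda_i & x_0^\top(\mathcal O_2^\top+\bar\mu\mathcal W_2^\top) & x_0^\top\bar\Phi_0^\top\mathcal C^{1/2}\\ (\mathcal O_2+\bar\mu\mathcal W_2)x_0 & \sum_i\bar\lambda_i\mathcal P_i+\mathcal O_3+\bar\mu\mathcal W_3 & \bar\Phi_w^\top\mathcal C^{1/2}\\ \mathcal C^{1/2}\bar\Phi_0x_0 & \mathcal C^{1/2}\bar\Phi_w & \mathcal I\end{bmatrix}\succeq 0 .$$ Let $\bar\mu^*_{\mathrm{PWB}}$ be the optimal level $\bar\mu$ (the infimum) for which some causal linear controller $\mathbf u=\mathcal K\mathbf x$ ($\mathcal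 K$ block lower triangular) satisfies $$J(\delta,\mathbf u)-J^*(\delta)\le\bar\mu\,\delta^\top\mathcal W_w\delta\qquad\text{for all }\mathbf w\in\mathbb W^T .$$ Then both problems are feasible with objective bounded below, and $$\frac{2}{\pi\,\kappa(\mathcal W_w)}\,\bar\mu^*\le\bar\mu^*_{\mathrm{PWB}},\qquad \kappa(\mathcal W_w)=\frac{\sigma_{\max}(\mathcal W_w)}{\sigma_{\min}(\mathcal W_w)} .$$ The same holds when $\bar\mu^*_{\mathrm{PWB}}$ is taken over all control laws $\mathbf u=\Phi_u\delta$ that come from a system response $\Phi$. -/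

import Mathlib

open scoped Matrix MatrixOrder

namespace GenRegret

noncomputable section

/-- Data of the finite-horizon, linear time-varying control problem: system matrices
`x_{k+1} = A_k x_k + B_k u_k + E_k w_k` and stage cost matrices `Q_k`, `R_k`. -/
structure LTVSystem (n m p T : ℕ) where
  A : Fin (T + 1) → Matrix (Fin n) (Fin n) ℝ
  B : Fin (T + 1) → Matrix (Fin n) (Fin m) ℝ
  E : Fin T → Matrix (Fin n) (Fin p) ℝ
  Q : Fin (T + 1) → Matrix (Fin n) (Fin n) ℝ
  R : Fin (T + 1) → Matrix (Fin m) (Fin m) ℝ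

/-- Positions in the stacked sequence `(x_0, …, x_T)`: (coordinate, time). -/
abbrev StateIdx (n T : ℕ) := Fin n × Fin (T + 1)

/-- Positions in the stacked sequence `(u_0, …, u_T)`: (coordinate, time). -/
abbrev InputIdx (m T : ℕ) := Fin m × Fin (T + 1)

/-- Positions in the stacked sequence `(w_0, …, w_{T-1})`: (coordinate, time). -/
abbrev DistIdx (p T : ℕ) := Fin p × Fin T

/-- Positions in `δ = (x_0, w)`. -/
abbrev DeltaIdx (n p T : ℕ) := Fin n ⊕ DistIdx p T

/-- `δ = (x_0, w)`. -/
def delta {n p T : ℕ} (x₀ : Fin n → ℝ) (w : DistIdx p T → ℝ) : DeltaIdx n p T → ℝ :=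
  Sum.elim x₀ w

/-- The ellipsoid `{v | vᵀ P v ≤ 1}`. -/
def ellipsoid {p : ℕ} (P : Matrix (Fin p) (Fin p) ℝ) : Set (Fin p → ℝ) :=
  {v | v ⬝ᵥ P *ᵥ v ≤ 1}

/-- The disturbance sequences all of whose entries `w_k` lie in the ellipsoid. -/
def pointwiseBounded {p : ℕ} (P : Matrix (Fin p) (Fin p) ℝ) (T : ℕ) :
    Set (DistIdx p T → ℝ) :=
  {w | ∀ k : Fin T, (fun b => w (b, k)) ∈ ellipsoid P}

namespace LTVSystem

variable {n m p T : ℕ} (S : LTVSystem n m p T)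

/-! ### Dynamics and cost -/

/-- The state sequence generated by the dynamics from `x_0`, the inputs and the disturbances. -/
def state (δ : DeltaIdx n p T → ℝ) (u : InputIdx m T → ℝ) (k : Fin (T + 1)) : Fin n → ℝ :=
  Fin.induction (motive := fun _ => Fin n → ℝ) (fun a => δ (Sum.inl a))
    (fun k xk => S.A k.castSucc *ᵥ xk + S.B k.castSucc *ᵥ (fun b => u (b, k.castSucc))
      + S.E k *ᵥ (fun b => δ (Sum.inr (b, k)))) k

/-- The cumulative cost `J = ∑_{k=0}^T x_kᵀ Q_k x_k + u_kᵀ R_k u_k`. -/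
def cost (δ : DeltaIdx n p T → ℝ) (u : InputIdx m T → ℝ) : ℝ :=
  ∑ k : Fin (T + 1), (S.state δ u k ⬝ᵥ S.Q k *ᵥ S.state δ u k
    + (fun b => u (b, k)) ⬝ᵥ S.R k *ᵥ (fun b => u (b, k)))

/-- The optimal non-causal cost: the least cost over all input sequences when `δ` is known. -/
def optCost (δ : DeltaIdx n p T → ℝ) : ℝ := ⨅ u : InputIdx m T → ℝ, S.cost δ u

/-! ### Stacked operators -/

/-- `blkdiag(A_0, …, A_T)`. -/
def bigA : Matrix (StateIdx n T) (StateIdx n T) ℝ := Matrix.blockDiagonal S.A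

/-- `blkdiag(B_0, …, B_T)`. -/
def bigB : Matrix (StateIdx n T) (InputIdx m T) ℝ := Matrix.blockDiagonal S.B

/-- `blkdiag(Q_0, …, Q_T)`. -/
def bigQ : Matrix (StateIdx n T) (StateIdx n T) ℝ := Matrix.blockDiagonal S.Q

/-- `blkdiag(R_0, …, R_T)`. -/
def bigR : Matrix (InputIdx m T) (InputIdx m T) ℝ := Matrix.blockDiagonal S.R

/-- `blkdiag(I, E_0, …, E_{T-1})`: block row `0` reads `x_0`, block row `k + 1` reads `w_k`. -/
def bigE : Matrix (StateIdx n T) (DeltaIdx n p T) ℝ := Matrix.of fun i c =>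
  match c with
  | Sum.inl a => if i.2 = 0 ∧ i.1 = a then 1 else 0
  | Sum.inr b => if i.2 = b.2.succ then S.E b.2 i.1 b.1 else 0

/-- `blkdiag(Q, R)` for the stacked cost matrices. -/
def bigC : Matrix (StateIdx n T ⊕ InputIdx m T) (StateIdx n T ⊕ InputIdx m T) ℝ :=
  Matrix.fromBlocks S.bigQ 0 0 S.bigR

/-- The block downshift operator: `(Z x)_0 = 0` and `(Z x)_{k+1} = x_k`. -/
def shift (n T : ℕ) : Matrix (StateIdx n T) (StateIdx n T) ℝ := Matrix.of fun i j =>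
  if i.1 = j.1 ∧ (i.2 : ℕ) = (j.2 : ℕ) + 1 then 1 else 0

/-- `F` in `x = F u + G δ`. -/
def opF : Matrix (StateIdx n T) (InputIdx m T) ℝ :=
  (1 - shift n T * S.bigA)⁻¹ * (shift n T * S.bigB)

/-- `G` in `x = F u + G δ`. -/
def opG : Matrix (StateIdx n T) (DeltaIdx n p T) ℝ :=
  (1 - shift n T * S.bigA)⁻¹ * S.bigE

/-- The matrix `O = Gᵀ Q (I + F R⁻¹ Fᵀ Q)⁻¹ G` of the optimal non-causal cost. -/
def opO : Matrix (DeltaIdx n p T) (DeltaIdx n p T) ℝ :=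
  S.opGᵀ * S.bigQ * (1 + S.opF * S.bigR⁻¹ * S.opFᵀ * S.bigQ)⁻¹ * S.opG

/-! ### System responses and controllers -/

/-- A causal system response: `x_k` and `u_k` depend on `x_0, w_0, …, w_{k-1}` only. -/
def CausalResponse
    (Φ : Matrix (StateIdx n T ⊕ InputIdx m T) (DeltaIdx n p T) ℝ) : Prop :=
  (∀ (a : Fin n) (k : Fin (T + 1)) (b : Fin p) (j : Fin T), k ≤ j.castSucc →
      Φ (Sum.inl (a, k)) (Sum.inr (b, j)) = 0) ∧
  (∀ (a : Fin m) (k : Fin (T + 1)) (b : Fin p) (j : Fin T), k ≤ j.castSucc →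
      Φ (Sum.inr (a, k)) (Sum.inr (b, j)) = 0)

/-- The system level constraint `[I - Z A, -Z B] Φ = E` on a causal response `Φ = [Φ_x; Φ_u]`. -/
def IsResponse (Φ : Matrix (StateIdx n T ⊕ InputIdx m T) (DeltaIdx n p T) ℝ) : Prop :=
  CausalResponse Φ ∧
    Matrix.fromCols (1 - shift n T * S.bigA) (-(shift n T * S.bigB)) * Φ = S.bigE

/-- A causal (block lower triangular) feedback matrix `K` for `u = K x`. -/
def CausalGain (K : Matrix (InputIdx m T) (StateIdx n T) ℝ) : Prop :=
  ∀ (b : Fin m) (k : Fin (T + 1)) (a : Fin n) (j : Fin (T + 1)), k < j → K (b, k) (a, j) = 0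

/-- The input response `Φ_u = K (I - Z (A + B K))⁻¹ E` of the closed loop under `u = K x`. -/
def closedLoopInput (K : Matrix (InputIdx m T) (StateIdx n T) ℝ) :
    Matrix (InputIdx m T) (DeltaIdx n p T) ℝ :=
  K * (1 - shift n T * (S.bigA + S.bigB * K))⁻¹ * S.bigE

/-! ### Pointwise-bounded regret levels -/

/-- The causal linear control law `u = U δ` has generalised regret level `μ` over all pointwise
bounded disturbances: `J(δ, u) - J*(δ) ≤ μ δᵀ W δ`. -/
def HasRegretLevel (W : Matrix (DeltaIdx n p T) (DeltaIdx n p T) ℝ)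
    (P : Matrix (Fin p) (Fin p) ℝ) (x₀ : Fin n → ℝ)
    (U : Matrix (InputIdx m T) (DeltaIdx n p T) ℝ) (μ : ℝ) : Prop :=
  ∀ w ∈ pointwiseBounded P T,
    S.cost (delta x₀ w) (U *ᵥ delta x₀ w) - S.optCost (delta x₀ w)
      ≤ μ * (delta x₀ w ⬝ᵥ W *ᵥ delta x₀ w)

/-- The regret levels that are achieved by causal state feedback `u = K x`. -/
def feedbackLevels (W : Matrix (DeltaIdx n p T) (DeltaIdx n p T) ℝ)
    (P : Matrix (Fin p) (Fin p) ℝ) (x₀ : Fin n → ℝ) : Set ℝ :=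
  {μ | ∃ K : Matrix (InputIdx m T) (StateIdx n T) ℝ, CausalGain K ∧
    S.HasRegretLevel W P x₀ (S.closedLoopInput K) μ}

/-- The regret levels that are achieved by a system response `Φ = [Φ_x; Φ_u]`, i.e. by a causal
linear control law `u = Φ_u δ`. -/
def responseLevels (W : Matrix (DeltaIdx n p T) (DeltaIdx n p T) ℝ)
    (P : Matrix (Fin p) (Fin p) ℝ) (x₀ : Fin n → ℝ) : Set ℝ :=
  {μ | ∃ Φ : Matrix (StateIdx n T ⊕ InputIdx m T) (DeltaIdx n p T) ℝ, S.IsResponse Φ ∧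
    S.HasRegretLevel W P x₀ Φ.toRows₂ μ}

/-! ### The semi-definite program -/

/-- The block diagonal matrix with `P` as its `i`-th diagonal block and `0` elsewhere. -/
def bigP (P : Matrix (Fin p) (Fin p) ℝ) (i : Fin T) :
    Matrix (DistIdx p T) (DistIdx p T) ℝ :=
  Matrix.blockDiagonal (Pi.single i P)

/-- The matrix of the linear matrix inequality in the variables `μ`, `lam`, `Φ = [Φ_0, Φ_w]`. -/
def lmi (W : Matrix (DeltaIdx n p T) (DeltaIdx n p T) ℝ)
    (P : Matrix (Fin p) (Fin p) ℝ) (x₀ : Fin n → ℝ) (μ : ℝ) (lam : Fin T → ℝ)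
    (Φ : Matrix (StateIdx n T ⊕ InputIdx m T) (DeltaIdx n p T) ℝ) :
    Matrix ((Unit ⊕ DistIdx p T) ⊕ (StateIdx n T ⊕ InputIdx m T))
      ((Unit ⊕ DistIdx p T) ⊕ (StateIdx n T ⊕ InputIdx m T)) ℝ :=
  let X : Matrix (Fin n) Unit ℝ := Matrix.replicateCol Unit x₀
  let O₁ := S.opO.toBlocks₁₁
  let O₂ := S.opO.toBlocks₂₁
  let O₃ := S.opO.toBlocks₂₂
  let W₁ := W.toBlocks₁₁
  let W₂ := W.toBlocks₂₁
  let W₃ := W.toBlocks₂₂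
  let Φ₀ := Φ.toCols₁
  let Φw := Φ.toCols₂
  let Csqrt := CFC.sqrt S.bigC
  Matrix.fromBlocks
    (Matrix.fromBlocks
      (Xᵀ * (O₁ + μ • W₁) * X - (∑ i, lam i) • (1 : Matrix Unit Unit ℝ))
      (Xᵀ * (O₂ᵀ + μ • W₂ᵀ))
      ((O₂ + μ • W₂) * X)
      ((∑ i, lam i • bigP P i) + O₃ + μ • W₃))
    (Matrix.fromRows (Xᵀ * Φ₀ᵀ * Csqrt) (Φwᵀ * Csqrt))
    (Matrix.fromCols (Csqrt * Φ₀ * X) (Csqrt * Φw))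
    1

/-- The values of `μ` that are feasible for the semi-definite program. -/
def sdpLevels (W : Matrix (DeltaIdx n p T) (DeltaIdx n p T) ℝ)
    (P : Matrix (Fin p) (Fin p) ℝ) (x₀ : Fin n → ℝ) : Set ℝ :=
  {μ | ∃ (lam : Fin T → ℝ) (Φ : Matrix (StateIdx n T ⊕ InputIdx m T) (DeltaIdx n p T) ℝ),
    (∀ i, 0 ≤ lam i) ∧ S.IsResponse Φ ∧ (S.lmi W P x₀ μ lam Φ).PosSemidef}

end LTVSystem

/-- The condition number `σ_max / σ_min` of a square matrix. Mathlib lists the singular values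
in decreasing order, starting from index `0`. -/
def condNumber {ι : Type*} [Fintype ι] [DecidableEq ι] (M : Matrix ι ι ℝ) : ℝ :=
  (Matrix.toEuclideanLin M).singularValues 0 /
    (Matrix.toEuclideanLin M).singularValues (Fintype.card ι - 1)

end

end GenRegret

/-!
The regret of a system response `Φ` is the quadratic form of `M = Φᵀ C Φ - O` in `δ = (x₀, w)`:
the stacked dynamics give `x = F u + G δ`, and completing the square in `u` shows that the optimal
non-causal cost is `δᵀ O δ` (`optCost_eq`, `IsResponse.regret_eq`). Causal feedback produces system
responses (`exists_isResponse_of_causalGain`), so it suffices to treat the latter. By the Schur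
complement, the semidefinite program at level `μ` asks for multipliers `λ ≥ 0` with
`δᵀ M δ ≤ μ δᵀ W δ + ∑ λ_i (w_iᵀ P w_i - t²)` for all `(t, w)`, where `δ = (t x₀, w)`
(`lmi_posSemidef_iff`). On the boundary of the ellipsoids the multipliers vanish, so that the levels
of both problems are nonnegative.

It remains to show that a level `μ` achieved on the product of ellipsoids yields the feasible level
`(π / 2) κ(W) μ` for the same `Φ` (`mul_mem_sdpLevels`). By duality (`exists_multipliers`) the
multipliers exist as soon as the inequality holds in the mean for every covariance matrix that
satisfies the ellipsoid constraints in the mean. Given a Gaussian vector `ξ` with such a covariance,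
every block is expanded in a `P`-orthonormal basis that makes its coordinates uncorrelated, and each
coordinate is replaced by its standard deviation times its sign. The result `v` satisfies the
ellipsoid constraints pathwise, has the same mean squares as `ξ`, and satisfies
`E[v ξᵀ] = √(2/π) E[ξ ξᵀ]` (`exists_rounding`). Expanding `0 ≤ E[(v - √(2/π) ξ)ᵀ M (v - √(2/π) ξ)]`
gives `E[ξᵀ M ξ] ≤ (π / 2) E[vᵀ M v]`. The regret bound applies to `v`, and since the mean squares
agree, passing from `E[vᵀ W v]` back to `E[ξᵀ W ξ]` costs the factor `κ(W)`
(`sum_mul_inner_le_of_bound`, `exists_multipliers_of_bound`).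
-/

namespace GenRegret

noncomputable section

/-! ### Signs of Gaussian projections -/

section GaussianSigns

open MeasureTheory ProbabilityTheory

/-- The sign of a real number with the convention `sgn 0 = 1`, so that its square is always `1`. -/
def sgn (x : ℝ) : ℝ := if 0 ≤ x then 1 else -1

lemma sgn_mul_self (x : ℝ) : sgn x * sgn x = 1 := by
  unfold sgn; split_ifs <;> norm_num

lemma abs_sgn (x : ℝ) : |sgn x| = 1 := by
  unfold sgn; split_ifs <;> norm_num

lemma sgn_mul_eq_abs (x : ℝ) : sgn x * x = |x| := by
  unfold sgn; split_ifs with h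
  · rw [abs_of_nonneg h, one_mul]
  · rw [abs_of_neg (not_le.1 h), neg_one_mul]

lemma sgn_neg {x : ℝ} (hx : x ≠ 0) : sgn (-x) = -sgn x := by
  unfold sgn
  rcases lt_or_gt_of_ne hx with h | h
  · rw [if_pos (by linarith), if_neg (not_le.2 h)]; norm_num
  · rw [if_neg (by linarith), if_pos h.le]

@[fun_prop]
lemma measurable_sgn : Measurable sgn :=
  Measurable.ite measurableSet_Ici measurable_const measurable_const

lemma integral_abs_gaussianReal : ∫ x, |x| ∂(gaussianReal 0 1) = √(2 / Real.pi) := by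
  rw [integral_gaussianReal_eq_integral_smul one_ne_zero]
  have h1 : ∀ x : ℝ, gaussianPDFReal 0 1 x • |x|
      = (fun y : ℝ => (√(2 * Real.pi))⁻¹ * (y ^ (1 : ℝ) * Real.exp (-(1 / 2) * y ^ (2 : ℝ)))) |x| := by
    intro x
    simp only [gaussianPDFReal, smul_eq_mul, Real.rpow_one, Real.rpow_two, sq_abs, NNReal.coe_one,
      mul_one, sub_zero]
    rw [show -x ^ 2 / 2 = -(1 / 2) * x ^ 2 by ring]; ring
  simp_rw [h1]
  rw [integral_comp_abs (f := fun y : ℝ => (√(2 * Real.pi))⁻¹ *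
      (y ^ (1 : ℝ) * Real.exp (-(1 / 2) * y ^ (2 : ℝ)))), integral_const_mul,
    integral_rpow_mul_exp_neg_mul_rpow (by norm_num) (by norm_num) (by norm_num)]
  norm_num
  have hp := Real.pi_pos
  have h2 : (√Real.pi) ≠ 0 := by positivity
  have h3 : (√2 : ℝ) ≠ 0 := by positivity
  field_simp
  norm_num

open scoped RealInnerProductSpace

variable {E : Type*} [NormedAddCommGroup E] [InnerProductSpace ℝ E]

lemma inner_reflection_self (v g : E) : ⟪v, (ℝ ∙ v)ᗮ.reflection g⟫ = -⟪v, g⟫ := by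
  rw [← Submodule.reflection_symm, ← LinearIsometryEquiv.inner_map_eq_flip]
  simp [Submodule.reflection_orthogonalComplement_singleton_eq_neg]

lemma inner_reflection_of_orthogonal {u v : E} (h : ⟪v, u⟫ = 0) (g : E) :
    ⟪u, (ℝ ∙ v)ᗮ.reflection g⟫ = ⟪u, g⟫ := by
  rw [← Submodule.reflection_symm, ← LinearIsometryEquiv.inner_map_eq_flip,
    Submodule.reflection_mem_subspace_eq_self (Submodule.mem_orthogonal_singleton_iff_inner_right.2 h)]

variable [FiniteDimensional ℝ E] [MeasurableSpace E] [BorelSpace E]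

lemma map_inner_stdGaussian {u : E} (hu : ‖u‖ = 1) :
    (stdGaussian E).map (fun g => ⟪u, g⟫) = gaussianReal 0 1 := by
  have h := IsGaussian.map_eq_gaussianReal (μ := stdGaussian E) (innerSL ℝ u)
  rw [integral_strongDual_stdGaussian, variance_dual_stdGaussian, innerSL_apply_norm, hu] at h
  simpa using h

lemma integrable_inner_stdGaussian (l : E) :
    Integrable (fun g => ⟪l, g⟫) (stdGaussian E) :=
  (IsGaussian.integrable_id (μ := stdGaussian E)).const_inner l

lemma integrable_inner_mul_inner_stdGaussian (l l' : E) :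
    Integrable (fun g => ⟪l, g⟫ * ⟪l', g⟫) (stdGaussian E) :=
  MemLp.integrable_mul (p := 2) (q := 2)
    ((IsGaussian.memLp_id (stdGaussian E) 2 (by simp)).const_inner l)
    ((IsGaussian.memLp_id (stdGaussian E) 2 (by simp)).const_inner l')

lemma integrable_sgn_mul_inner (f l : E) :
    Integrable (fun g => sgn ⟪f, g⟫ * ⟪l, g⟫) (stdGaussian E) :=
  (integrable_inner_stdGaussian l).bdd_mul (c := 1) (Measurable.aestronglyMeasurable (by fun_prop))
    (Filter.Eventually.of_forall fun g => by simp [abs_sgn])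

lemma integrable_sgn_mul_sgn (f l : E) :
    Integrable (fun g => sgn ⟪f, g⟫ * sgn ⟪l, g⟫) (stdGaussian E) :=
  Integrable.of_bound (by fun_prop) 1
    (Filter.Eventually.of_forall fun g => by simp [abs_sgn])

lemma integral_inner_mul_inner (l l' : E) :
    ∫ g, ⟪l, g⟫ * ⟪l', g⟫ ∂(stdGaussian E) = ⟪l, l'⟫ := by
  have h : covarianceBilin (stdGaussian E) l l' = ⟪l, l'⟫ := by
    rw [covarianceBilin_stdGaussian]; rfl
  rw [covarianceBilin_apply (IsGaussian.memLp_id (stdGaussian E) 2 (by simp))] at h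
  simpa [integral_id_stdGaussian] using h

/-- The standard Gaussian measure is invariant under the reflection that flips `v`. -/
lemma integral_comp_reflection_stdGaussian (v : E) (F : E → ℝ) :
    ∫ g, F ((ℝ ∙ v)ᗮ.reflection g) ∂(stdGaussian E) = ∫ g, F g ∂(stdGaussian E) := by
  conv_rhs => rw [← stdGaussian_map ((ℝ ∙ v)ᗮ.reflection)]
  exact (integral_map_equiv ((ℝ ∙ v)ᗮ.reflection.toHomeomorph.toMeasurableEquiv) F).symm

lemma integral_sgn_mul_inner_of_orthogonal {f v : E} (h : ⟪v, f⟫ = 0) :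
    ∫ g, sgn ⟪f, g⟫ * ⟪v, g⟫ ∂(stdGaussian E) = 0 := by
  have h1 := integral_comp_reflection_stdGaussian v (fun g => sgn ⟪f, g⟫ * ⟪v, g⟫)
  simp only [inner_reflection_self, inner_reflection_of_orthogonal h, mul_neg,
    integral_neg] at h1
  linarith

lemma ae_inner_ne_zero {v : E} (hv : v ≠ 0) : ∀ᵐ g ∂(stdGaussian E), ⟪v, g⟫ ≠ 0 := by
  have hu : ‖(‖v‖⁻¹ • v)‖ = 1 := norm_smul_inv_norm hv
  have hm := map_inner_stdGaussian hu
  have h0 : gaussianReal 0 1 {(0 : ℝ)} = 0 := by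
    have := nullSingletonClass_gaussianReal (μ := 0) (v := 1) one_ne_zero
    exact measure_singleton 0
  rw [← hm, Measure.map_apply (by fun_prop) (measurableSet_singleton 0)] at h0
  rw [ae_iff]
  refine measure_mono_null (fun g hg => ?_) h0
  simp only [ne_eq, not_not, Set.mem_ofPred_eq] at hg
  simp [real_inner_smul_left, hg]

/-- Flipping `v` shows that the signs of two uncorrelated Gaussian variables are uncorrelated. -/
lemma integral_sgn_mul_sgn_of_orthogonal {f v : E} (hv : v ≠ 0) (h : ⟪v, f⟫ = 0) :
    ∫ g, sgn ⟪f, g⟫ * sgn ⟪v, g⟫ ∂(stdGaussian E) = 0 := by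
  have h1 := integral_comp_reflection_stdGaussian v (fun g => sgn ⟪f, g⟫ * sgn ⟪v, g⟫)
  simp only [inner_reflection_self, inner_reflection_of_orthogonal h] at h1
  have h2 : ∫ g, sgn ⟪f, g⟫ * sgn (-⟪v, g⟫) ∂(stdGaussian E)
      = ∫ g, -(sgn ⟪f, g⟫ * sgn ⟪v, g⟫) ∂(stdGaussian E) := by
    refine integral_congr_ae ?_
    filter_upwards [ae_inner_ne_zero hv] with g hg
    rw [sgn_neg hg, mul_neg]
  rw [h2, integral_neg] at h1
  linarith

/-- Correlation of a Gaussian variable with the sign of another one. Split `l` into its component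
along `f`, which gives the mean of `|⟪f, g⟫|`, and an orthogonal one, which does not contribute. -/
lemma norm_mul_integral_sgn_mul_inner (f l : E) :
    ‖f‖ * ∫ g, sgn ⟪f, g⟫ * ⟪l, g⟫ ∂(stdGaussian E) = √(2 / Real.pi) * ⟪f, l⟫ := by
  rcases eq_or_ne f 0 with rfl | hf
  · simp
  have hn : ‖f‖ ≠ 0 := norm_ne_zero_iff.2 hf
  have habs : ∫ g, |⟪f, g⟫| ∂(stdGaussian E) = ‖f‖ * √(2 / Real.pi) := by
    rw [← integral_abs_gaussianReal, ← map_inner_stdGaussian (norm_smul_inv_norm (𝕜 := ℝ) hf),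
      integral_map (by fun_prop) (by fun_prop), ← integral_const_mul]
    congr 1; ext g
    rw [real_inner_smul_left, abs_mul]
    simp
    field_simp
  set c : ℝ := ⟪f, l⟫ / ‖f‖ ^ 2 with hc
  have horth : ⟪l - c • f, f⟫ = 0 := by
    rw [inner_sub_left, real_inner_smul_left, real_inner_self_eq_norm_sq, real_inner_comm, hc]
    field_simp; ring
  have hsplit : ∀ g, sgn ⟪f, g⟫ * ⟪l, g⟫
      = c * |⟪f, g⟫| + sgn ⟪f, g⟫ * ⟪l - c • f, g⟫ := by
    intro g
    rw [← sgn_mul_eq_abs, inner_sub_left, real_inner_smul_left]; ring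
  simp_rw [hsplit]
  rw [integral_add ((integrable_inner_stdGaussian f).abs.const_mul c)
    (integrable_sgn_mul_inner f _), integral_sgn_mul_inner_of_orthogonal horth,
    integral_const_mul, habs, hc]
  field_simp; ring

end GaussianSigns

/-! ### Rounding a Gaussian vector into the product of ellipsoids -/

section Rounding

open MeasureTheory ProbabilityTheory
open scoped RealInnerProductSpace

section RoundedProjection

variable {E : Type*} [NormedAddCommGroup E] [InnerProductSpace ℝ E]

/-- The random variable with two values that has the sign and the standard deviation of the
Gaussian variable `⟪f, g⟫`, for a standard Gaussian vector `g`. -/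
def roundedProj (f g : E) : ℝ := ‖f‖ * sgn ⟪f, g⟫

lemma roundedProj_mul_self (f g : E) : roundedProj f g * roundedProj f g = ⟪f, f⟫ := by
  rw [roundedProj, mul_mul_mul_comm, sgn_mul_self, mul_one, real_inner_self_eq_norm_mul_norm]

variable [FiniteDimensional ℝ E] [MeasurableSpace E] [BorelSpace E]

lemma integrable_roundedProj_mul_inner (f l : E) :
    Integrable (fun g => roundedProj f g * ⟪l, g⟫) (stdGaussian E) := by
  simpa only [roundedProj, mul_assoc] using (integrable_sgn_mul_inner f l).const_mul ‖f‖

lemma integrable_roundedProj_mul_roundedProj (f l : E) :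
    Integrable (fun g => roundedProj f g * roundedProj l g) (stdGaussian E) := by
  refine ((integrable_sgn_mul_sgn f l).const_mul (‖f‖ * ‖l‖)).congr
    (Filter.Eventually.of_forall fun g => ?_)
  simp only [roundedProj]; ring

lemma integral_roundedProj_mul_inner (f l : E) :
    ∫ g, roundedProj f g * ⟪l, g⟫ ∂(stdGaussian E) = √(2 / Real.pi) * ⟪f, l⟫ := by
  simp_rw [← norm_mul_integral_sgn_mul_inner, roundedProj, mul_assoc, integral_const_mul]

lemma integral_roundedProj_mul_self (f : E) :
    ∫ g, roundedProj f g * roundedProj f g ∂(stdGaussian E) = ⟪f, f⟫ := by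
  simp [roundedProj_mul_self]

lemma integral_roundedProj_mul_of_orthogonal {f l : E} (h : ⟪l, f⟫ = 0) :
    ∫ g, roundedProj f g * roundedProj l g ∂(stdGaussian E) = 0 := by
  rcases eq_or_ne l 0 with rfl | hl
  · simp [roundedProj]
  · have h1 : ∀ g, roundedProj f g * roundedProj l g
        = ‖f‖ * ‖l‖ * (sgn ⟪f, g⟫ * sgn ⟪l, g⟫) := fun g => by simp only [roundedProj]; ring
    simp_rw [h1, integral_const_mul, integral_sgn_mul_sgn_of_orthogonal hl h, mul_zero]

end RoundedProjection

lemma transpose_sqrt {ι : Type*} [Fintype ι] [DecidableEq ι] (M : Matrix ι ι ℝ) :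
    (CFC.sqrt M)ᵀ = CFC.sqrt M := by
  have h := (CFC.sqrt_nonneg M).isSelfAdjoint
  rwa [isSelfAdjoint_iff, Matrix.star_eq_conjTranspose, Matrix.conjTranspose_eq_transpose_of_trivial]
    at h

lemma sqrt_mul_sqrt_of_posSemidef {ι : Type*} [Fintype ι] [DecidableEq ι] {M : Matrix ι ι ℝ}
    (hM : M.PosSemidef) : CFC.sqrt M * CFC.sqrt M = M :=
  CFC.sqrt_mul_sqrt_self M hM.nonneg

/-- Simultaneous diagonalisation of a positive definite and a symmetric matrix. -/
lemma exists_simultaneous_diagonalization {ι : Type*} [Fintype ι] [DecidableEq ι]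
    {P V : Matrix ι ι ℝ} (hP : P.PosDef) (hV : V.PosSemidef) :
    ∃ (B : Matrix ι ι ℝ) (d : ι → ℝ), Bᵀ * P * B = 1 ∧ B * (Bᵀ * P) = 1 ∧
      Bᵀ * P * V * (Bᵀ * P)ᵀ = Matrix.diagonal d := by
  set R := CFC.sqrt P
  have hRR : R * R = P := sqrt_mul_sqrt_of_posSemidef hP.posSemidef
  have hRt : Rᵀ = R := transpose_sqrt P
  have hRu : IsUnit R := by
    have := hP.isUnit
    rw [← hRR] at this
    exact isUnit_of_mul_isUnit_left this
  have hRd : IsUnit R.det := (Matrix.isUnit_iff_isUnit_det R).1 hRu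
  have hH : (R * V * R).PosSemidef := by
    have := hV.mul_mul_conjTranspose_same R
    rwa [Matrix.conjTranspose_eq_transpose_of_trivial, hRt] at this
  set U : Matrix ι ι ℝ := (hH.1.eigenvectorUnitary : Matrix ι ι ℝ)
  have hUt : Uᵀ * U = 1 := by
    have := Unitary.coe_star_mul_self hH.1.eigenvectorUnitary
    rwa [Matrix.star_eq_conjTranspose, Matrix.conjTranspose_eq_transpose_of_trivial] at this
  have hsp := hH.1.spectral_theorem
  set e := hH.1.eigenvalues
  clear_value e
  rw [Unitary.conjStarAlgAut_apply, Matrix.star_eq_conjTranspose,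
    Matrix.conjTranspose_eq_transpose_of_trivial] at hsp
  change _ = U * _ * Uᵀ at hsp
  clear_value U
  have hBP : (R⁻¹ * U)ᵀ * P = Uᵀ * R := by
    rw [Matrix.transpose_mul, Matrix.transpose_nonsing_inv, hRt, ← hRR, Matrix.mul_assoc,
      ← Matrix.mul_assoc R⁻¹, Matrix.nonsing_inv_mul _ hRd, Matrix.one_mul]
  have h1 : (R⁻¹ * U)ᵀ * P * (R⁻¹ * U) = 1 := by
    rw [hBP, Matrix.mul_assoc, ← Matrix.mul_assoc R, Matrix.mul_nonsing_inv _ hRd, Matrix.one_mul,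
      hUt]
  refine ⟨R⁻¹ * U, e, h1, mul_eq_one_comm.1 h1, ?_⟩
  rw [hBP, Matrix.transpose_mul, Matrix.transpose_transpose, hRt]
  calc Uᵀ * R * V * (R * U) = Uᵀ * (R * V * R) * U := by simp only [Matrix.mul_assoc]
    _ = (Uᵀ * U) * Matrix.diagonal e * (Uᵀ * U) := by
        rw [hsp]
        simp only [Matrix.mul_assoc]
        rfl
    _ = _ := by rw [hUt, Matrix.one_mul, Matrix.mul_one]

/-- The block of a stacked vector `(t, w)` that belongs to time `i`. -/
abbrev block {p T : ℕ} (v : Unit ⊕ DistIdx p T → ℝ) (i : Fin T) : Fin p → ℝ :=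
  fun b => v (Sum.inr (b, i))

variable {E : Type*} [NormedAddCommGroup E] [InnerProductSpace ℝ E] [FiniteDimensional ℝ E]
  [MeasurableSpace E] [BorelSpace E]

/-- Let `ξ_a = ⟪l_a, g⟫` be a Gaussian vector whose blocks have mean square `P`-norm at most that of
its scalar entry. There is a random vector `v` that satisfies this bound pathwise, has the same mean
squares as `ξ`, and has the cross-covariance `√(2/π) Cov(ξ)` with `ξ`. Each block is expanded in a
`P`-orthonormal basis in which its coordinates are uncorrelated, and every coordinate is replaced by
its sign times its standard deviation. -/
theorem exists_rounding {p T : ℕ} {P : Matrix (Fin p) (Fin p) ℝ} (hP : P.PosDef)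
    (l : Unit ⊕ DistIdx p T → E)
    (hl : ∀ i, ∑ a, ∑ b, P a b * ⟪l (Sum.inr (a, i)), l (Sum.inr (b, i))⟫
      ≤ ⟪l (Sum.inl ()), l (Sum.inl ())⟫) :
    ∃ v : E → Unit ⊕ DistIdx p T → ℝ,
      (∀ g i, block (v g) i ⬝ᵥ P *ᵥ block (v g) i ≤ v g (Sum.inl ()) ^ 2) ∧
      (∀ a b, Integrable (fun g => v g a * v g b) (stdGaussian E)) ∧
      (∀ a f, Integrable (fun g => v g a * ⟪f, g⟫) (stdGaussian E)) ∧
      (∀ a, ∫ g, v g a * v g a ∂(stdGaussian E) = ⟪l a, l a⟫) ∧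
      (∀ a f, ∫ g, v g a * ⟪f, g⟫ ∂(stdGaussian E) = √(2 / Real.pi) * ⟪l a, f⟫) := by
  have hPt : Pᵀ = P := by
    rw [← Matrix.conjTranspose_eq_transpose_of_trivial]; exact hP.1
  have hV : ∀ i, (Matrix.gram ℝ fun a : Fin p => l (Sum.inr (a, i))).PosSemidef :=
    fun i => Matrix.posSemidef_gram ℝ _
  choose B d hB1 hB2 hB3 using fun i => exists_simultaneous_diagonalization hP (hV i)
  let f : Fin T → Fin p → E := fun i b => ∑ c, ((B i)ᵀ * P) b c • l (Sum.inr (c, i))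
  -- The coordinates `⟪f i b, g⟫` of block `i` are uncorrelated.
  have hf : ∀ i b c, ⟪f i b, f i c⟫ = Matrix.diagonal (d i) b c := by
    intro i b c
    rw [← hB3]
    simp only [f, sum_inner, inner_sum, real_inner_smul_left, real_inner_smul_right,
      Matrix.mul_apply (M := (B i)ᵀ * P * _), Matrix.mul_apply (N := Matrix.gram ℝ _),
      Matrix.gram_apply, Matrix.transpose_apply (M := (B i)ᵀ * P), Finset.sum_mul]
    refine Finset.sum_congr rfl fun x _ => Finset.sum_congr rfl fun y _ => ?_
    ring
  have hlf : ∀ i a, l (Sum.inr (a, i)) = ∑ b, B i a b • f i b := by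
    intro i a
    simp only [f, Finset.smul_sum, smul_smul]
    rw [Finset.sum_comm]
    simp_rw [← Finset.sum_smul, ← Matrix.mul_apply, hB2, Matrix.one_apply]
    simp
  let v : E → Unit ⊕ DistIdx p T → ℝ := fun g c =>
    match c with
    | Sum.inl _ => roundedProj (l (Sum.inl ())) g
    | Sum.inr (a, i) => ∑ b, B i a b * roundedProj (f i b) g
  have hint : ∀ a c, Integrable (fun g => v g a * v g c) (stdGaussian E) := by
    rintro (a | ⟨a, i⟩) (c | ⟨c, j⟩)
    · exact integrable_roundedProj_mul_roundedProj _ _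
    · simp only [v, Finset.mul_sum]
      refine integrable_finsetSum _ fun b _ => ?_
      simp_rw [mul_left_comm _ (B j c b)]
      exact (integrable_roundedProj_mul_roundedProj _ _).const_mul _
    · simp only [v, Finset.sum_mul]
      refine integrable_finsetSum _ fun b _ => ?_
      simp_rw [mul_assoc]
      exact (integrable_roundedProj_mul_roundedProj _ _).const_mul _
    · simp only [v, Finset.sum_mul, Finset.mul_sum]
      refine integrable_finsetSum _ fun b _ => integrable_finsetSum _ fun e _ => ?_
      simp_rw [mul_mul_mul_comm]
      exact (integrable_roundedProj_mul_roundedProj _ _).const_mul _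
  refine ⟨v, ?_, hint, ?_, ?_, ?_⟩
  · intro g i
    have h1 : block (v g) i = B i *ᵥ fun b => roundedProj (f i b) g := by
      ext a; rfl
    -- Signs square to `1`, so that the `P`-norm of the rounded block does not depend on `g`.
    have h2 : block (v g) i ⬝ᵥ P *ᵥ block (v g) i = ∑ b, ⟪f i b, f i b⟫ := by
      rw [h1, Matrix.mulVec_mulVec, Matrix.dotProduct_mulVec, ← Matrix.mulVec_transpose,
        Matrix.mulVec_mulVec, Matrix.transpose_mul, hPt, hB1, Matrix.one_mulVec]
      exact Finset.sum_congr rfl fun b _ => roundedProj_mul_self _ _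
    have h3 : ∑ b, ⟪f i b, f i b⟫
        = ∑ a, ∑ b, P a b * ⟪l (Sum.inr (a, i)), l (Sum.inr (b, i))⟫ := by
      have h4 : P * B i * ((B i)ᵀ * P) = P := by rw [Matrix.mul_assoc, hB2, Matrix.mul_one]
      have h5 : ((B i)ᵀ * P)ᵀ * ((B i)ᵀ * P) = P := by
        rw [Matrix.transpose_mul, Matrix.transpose_transpose, hPt, h4]
      have h6 : ∑ b, ⟪f i b, f i b⟫ = Matrix.trace (Matrix.diagonal (d i)) :=
        Finset.sum_congr rfl fun b _ => hf i b b
      rw [h6, ← hB3, Matrix.trace_mul_comm, ← Matrix.mul_assoc, h5, Matrix.trace]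
      refine Finset.sum_congr rfl fun a _ => ?_
      rw [Matrix.diag_apply, Matrix.mul_apply]
      refine Finset.sum_congr rfl fun b _ => ?_
      rw [Matrix.gram_apply, real_inner_comm]
    rw [h2, h3, sq]
    exact (hl i).trans_eq (roundedProj_mul_self _ _).symm
  · rintro (a | ⟨a, i⟩) f'
    · exact integrable_roundedProj_mul_inner _ _
    · simp only [v, Finset.sum_mul, mul_assoc]
      exact integrable_finsetSum _ fun b _ => (integrable_roundedProj_mul_inner _ _).const_mul _
  · rintro (a | ⟨a, i⟩)
    · exact integral_roundedProj_mul_self _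
    · have hv : ∀ g, v g (Sum.inr (a, i)) * v g (Sum.inr (a, i))
          = ∑ b, ∑ e, B i a b * B i a e * (roundedProj (f i b) g * roundedProj (f i e) g) := by
        intro g
        rw [Finset.sum_mul_sum]
        refine Finset.sum_congr rfl fun b _ => Finset.sum_congr rfl fun e _ => ?_
        ring
      simp_rw [hv]
      rw [integral_finsetSum _ fun b _ => integrable_finsetSum _ fun e _ =>
        (integrable_roundedProj_mul_roundedProj _ _).const_mul _]
      have : ∀ b, ∫ g, ∑ e, B i a b * B i a e * (roundedProj (f i b) g * roundedProj (f i e) g)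
          ∂(stdGaussian E) = B i a b * B i a b * ⟪f i b, f i b⟫ := by
        intro b
        rw [integral_finsetSum _ fun e _ =>
          (integrable_roundedProj_mul_roundedProj _ _).const_mul _,
          Finset.sum_eq_single b]
        · rw [integral_const_mul, integral_roundedProj_mul_self]
        · intro e _ he
          rw [integral_const_mul, integral_roundedProj_mul_of_orthogonal, mul_zero]
          rw [hf, Matrix.diagonal_apply_ne _ he]
        · simp
      simp_rw [this]
      conv_rhs => rw [hlf]
      simp only [sum_inner, inner_sum, real_inner_smul_left, real_inner_smul_right]
      refine Finset.sum_congr rfl fun b _ => ?_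
      rw [Finset.sum_eq_single b]
      · ring
      · intro e _ he
        rw [hf, Matrix.diagonal_apply_ne _ he]; simp
      · simp
  · rintro (a | ⟨a, i⟩) f'
    · exact integral_roundedProj_mul_inner _ _
    · simp only [v, Finset.sum_mul, mul_assoc]
      rw [integral_finsetSum _ fun b _ => (integrable_roundedProj_mul_inner _ _).const_mul _, hlf]
      simp only [sum_inner, real_inner_smul_left, integral_const_mul,
        integral_roundedProj_mul_inner, Finset.mul_sum]
      refine Finset.sum_congr rfl fun b _ => ?_
      ring

end Rounding

/-! ### Quality of the semidefinite relaxation -/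

section Relaxation

open MeasureTheory ProbabilityTheory
open scoped RealInnerProductSpace

lemma dotProduct_mulVec_eq_sum {ι : Type*} [Fintype ι] (M : Matrix ι ι ℝ) (v u : ι → ℝ) :
    v ⬝ᵥ M *ᵥ u = ∑ a, ∑ b, M a b * (v a * u b) := by
  simp only [dotProduct, Matrix.mulVec, Finset.mul_sum]
  refine Finset.sum_congr rfl fun a _ => Finset.sum_congr rfl fun b _ => ?_
  ring

section Gram

variable {E : Type*} [NormedAddCommGroup E] [InnerProductSpace ℝ E] [FiniteDimensional ℝ E]
  [MeasurableSpace E] [BorelSpace E]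

/-- If the cross-covariance of `v` with the Gaussian vector `ξ_a = ⟪l_a, g⟫` is `k Cov(ξ)` with
`k = √(2/π)`, then `E[vᵀ M v] ≥ (2/π) E[ξᵀ M ξ]` for positive semidefinite `M`: expand
`0 ≤ E[(v - k ξ)ᵀ M (v - k ξ)]`. -/
lemma sum_mul_inner_le_integral {ι : Type*} [Fintype ι] {M : Matrix ι ι ℝ} (hM : M.PosSemidef)
    (l : ι → E) (v : E → ι → ℝ)
    (h1 : ∀ a b, Integrable (fun g => v g a * v g b) (stdGaussian E))
    (h2 : ∀ a f, Integrable (fun g => v g a * ⟪f, g⟫) (stdGaussian E))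
    (h3 : ∀ a f, ∫ g, v g a * ⟪f, g⟫ ∂(stdGaussian E) = √(2 / Real.pi) * ⟪l a, f⟫) :
    ∑ a, ∑ b, M a b * ⟪l a, l b⟫ ≤ Real.pi / 2 * ∫ g, v g ⬝ᵥ M *ᵥ v g ∂(stdGaussian E) := by
  set k := √(2 / Real.pi) with hk
  have hkk : k * k = 2 / Real.pi := Real.mul_self_sqrt (by positivity)
  set ξ : E → ι → ℝ := fun g a => ⟪l a, g⟫ with hξ
  have hpos : 0 ≤ ∫ g, (v g - k • ξ g) ⬝ᵥ M *ᵥ (v g - k • ξ g) ∂(stdGaussian E) :=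
    integral_nonneg fun g => by simpa using hM.dotProduct_mulVec_nonneg (v g - k • ξ g)
  have hexp : ∀ g, (v g - k • ξ g) ⬝ᵥ M *ᵥ (v g - k • ξ g) = v g ⬝ᵥ M *ᵥ v g
      + ∑ a, ∑ b, M a b * (k * k * (⟪l a, g⟫ * ⟪l b, g⟫)
        - k * (v g a * ⟪l b, g⟫) - k * (v g b * ⟪l a, g⟫)) := by
    intro g
    simp only [dotProduct_mulVec_eq_sum, ← Finset.sum_add_distrib]
    refine Finset.sum_congr rfl fun a _ => Finset.sum_congr rfl fun b _ => ?_
    simp only [Pi.sub_apply, Pi.smul_apply, smul_eq_mul, hξ]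
    ring
  have hterm : ∀ a b, Integrable (fun g => M a b * (k * k * (⟪l a, g⟫ * ⟪l b, g⟫)
        - k * (v g a * ⟪l b, g⟫) - k * (v g b * ⟪l a, g⟫))) (stdGaussian E) := fun a b =>
    (((((integrable_inner_mul_inner_stdGaussian _ _).const_mul _).sub
      ((h2 _ _).const_mul _)).sub ((h2 _ _).const_mul _)).const_mul _)
  have hval : ∀ a b, ∫ g, M a b * (k * k * (⟪l a, g⟫ * ⟪l b, g⟫)
        - k * (v g a * ⟪l b, g⟫) - k * (v g b * ⟪l a, g⟫)) ∂(stdGaussian E)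
        = - (2 / Real.pi) * (M a b * ⟪l a, l b⟫) := by
    intro a b
    rw [integral_const_mul, integral_sub, integral_sub]
    · simp only [integral_const_mul, integral_inner_mul_inner, h3]
      rw [← mul_assoc k k, ← mul_assoc k k, hkk, real_inner_comm (l a) (l b)]
      ring
    · exact (integrable_inner_mul_inner_stdGaussian _ _).const_mul _
    · exact (h2 _ _).const_mul _
    · exact ((integrable_inner_mul_inner_stdGaussian _ _).const_mul _).sub ((h2 _ _).const_mul _)
    · exact (h2 _ _).const_mul _
  have hvv : Integrable (fun g => v g ⬝ᵥ M *ᵥ v g) (stdGaussian E) := by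
    simp only [dotProduct_mulVec_eq_sum]
    exact integrable_finsetSum _ fun a _ => integrable_finsetSum _ fun b _ => (h1 a b).const_mul _
  simp_rw [hexp] at hpos
  rw [integral_add hvv (integrable_finsetSum _ fun a _ => integrable_finsetSum _ fun b _ =>
      hterm a b), integral_finsetSum _ fun a _ => integrable_finsetSum _ fun b _ => hterm a b] at hpos
  simp_rw [integral_finsetSum _ fun b _ => hterm _ b, hval, ← Finset.mul_sum] at hpos
  have hpi := Real.pi_pos
  have h5 : (2 / Real.pi) * ∑ a, ∑ b, M a b * ⟪l a, l b⟫
      ≤ ∫ g, v g ⬝ᵥ M *ᵥ v g ∂(stdGaussian E) := by linarith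
  calc ∑ a, ∑ b, M a b * ⟪l a, l b⟫
      = Real.pi / 2 * ((2 / Real.pi) * ∑ a, ∑ b, M a b * ⟪l a, l b⟫) := by field_simp
    _ ≤ _ := mul_le_mul_of_nonneg_left h5 (by positivity)

/-- The loss of the semidefinite relaxation. The bound `M ≤ μ N` on the product of ellipsoids
passes to Gram matrices that satisfy the ellipsoid constraints on average, at the price of the
factor `π / 2` from rounding and `s₂ / s₁` from comparing `N` with the diagonal form `D`, whose
mean is not changed by rounding. -/
theorem sum_mul_inner_le_of_bound {p T : ℕ} {P : Matrix (Fin p) (Fin p) ℝ} (hP : P.PosDef)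
    {M N : Matrix (Unit ⊕ DistIdx p T) (Unit ⊕ DistIdx p T) ℝ} (hM : M.PosSemidef)
    {D : Unit ⊕ DistIdx p T → ℝ} {s₂ μ : ℝ} (hμ : 0 ≤ μ)
    (hN : ∀ v : Unit ⊕ DistIdx p T → ℝ, v ⬝ᵥ N *ᵥ v ≤ s₂ * ∑ a, D a * v a ^ 2)
    (hMN : ∀ v : Unit ⊕ DistIdx p T → ℝ,
      (∀ i, block v i ⬝ᵥ P *ᵥ block v i ≤ v (Sum.inl ()) ^ 2) →
      v ⬝ᵥ M *ᵥ v ≤ μ * (v ⬝ᵥ N *ᵥ v))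
    (l : Unit ⊕ DistIdx p T → E)
    (hl : ∀ i, ∑ a, ∑ b, P a b * ⟪l (Sum.inr (a, i)), l (Sum.inr (b, i))⟫
      ≤ ⟪l (Sum.inl ()), l (Sum.inl ())⟫) :
    ∑ a, ∑ b, M a b * ⟪l a, l b⟫ ≤ Real.pi / 2 * (μ * (s₂ * ∑ a, D a * ⟪l a, l a⟫)) := by
  obtain ⟨v, hv1, hv2, hv3, hv4, hv5⟩ := exists_rounding hP l hl
  have hint : ∀ K : Matrix (Unit ⊕ DistIdx p T) (Unit ⊕ DistIdx p T) ℝ,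
      Integrable (fun g => v g ⬝ᵥ K *ᵥ v g) (stdGaussian E) := by
    intro K
    simp only [dotProduct_mulVec_eq_sum]
    exact integrable_finsetSum _ fun a _ => integrable_finsetSum _ fun b _ => (hv2 a b).const_mul _
  have hsq : ∀ a, Integrable (fun g => D a * v g a ^ 2) (stdGaussian E) := fun a => by
    simpa only [sq] using (hv2 a a).const_mul (D a)
  refine (sum_mul_inner_le_integral hM l v hv2 hv3 hv5).trans ?_
  refine mul_le_mul_of_nonneg_left ?_ (by positivity)
  calc ∫ g, v g ⬝ᵥ M *ᵥ v g ∂(stdGaussian E)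
      ≤ ∫ g, μ * (s₂ * ∑ a, D a * v g a ^ 2) ∂(stdGaussian E) := by
        refine integral_mono (hint M)
          (((integrable_finsetSum _ fun a _ => hsq a).const_mul _).const_mul _) fun g => ?_
        exact (hMN (v g) (hv1 g)).trans (mul_le_mul_of_nonneg_left (hN (v g)) hμ)
    _ = μ * (s₂ * ∑ a, D a * ⟪l a, l a⟫) := by
        rw [integral_const_mul, integral_const_mul, integral_finsetSum _ fun a _ => hsq a]
        simp_rw [integral_const_mul, sq, hv4]

end Gram

/-- Lossless Lagrangian duality for one quadratic form under homogeneous quadratic constraints that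
are relaxed to positive semidefinite matrices. The relaxed values form a convex cone in the space of
objective and constraint values, which is separated from the orthant of improving points; the Slater
point `Y₀` makes the multiplier of the objective nonzero. -/
theorem exists_multipliers {ι τ : Type*} [Fintype ι] [Fintype τ]
    (H : Matrix ι ι ℝ) (A : τ → Matrix ι ι ℝ) {Y₀ : Matrix ι ι ℝ} (hY₀ : Y₀.PosSemidef)
    (hslater : ∀ i, (A i * Y₀).trace < 0)
    (h : ∀ Y : Matrix ι ι ℝ, Y.PosSemidef → (∀ i, (A i * Y).trace < 0) → (H * Y).trace ≤ 0) :
    ∃ lam : τ → ℝ, (∀ i, 0 ≤ lam i) ∧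
      ∀ v : ι → ℝ, v ⬝ᵥ H *ᵥ v ≤ ∑ i, lam i * (v ⬝ᵥ A i *ᵥ v) := by
  classical
  let L : Matrix ι ι ℝ →ₗ[ℝ] ℝ × (τ → ℝ) :=
    { toFun := fun Y => ((H * Y).trace, fun i => (A i * Y).trace)
      map_add' := fun X Y => by ext <;> simp [mul_add]
      map_smul' := fun c Y => by ext <;> simp }
  have hconv : Convex ℝ {Y : Matrix ι ι ℝ | Y.PosSemidef} := fun X hX Y hY a b ha hb _ =>
    (hX.smul ha).add (hY.smul hb)
  have hopen : IsOpen (Set.Ioi (0 : ℝ) ×ˢ Set.univ.pi fun _ : τ => Set.Iio (0 : ℝ)) :=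
    isOpen_Ioi.prod (isOpen_set_pi Set.finite_univ fun _ _ => isOpen_Iio)
  have hdisj : Disjoint (Set.Ioi (0 : ℝ) ×ˢ Set.univ.pi fun _ : τ => Set.Iio (0 : ℝ))
      (L '' {Y : Matrix ι ι ℝ | Y.PosSemidef}) := by
    rw [Set.disjoint_left]
    rintro _ ⟨h1, h2⟩ ⟨Y, hY, rfl⟩
    exact absurd (h Y hY fun i => h2 i trivial) (not_le.2 h1)
  obtain ⟨f, u, hf1, hf2⟩ := geometric_hahn_banach_open
    ((convex_Ioi 0).prod (convex_pi fun _ _ => convex_Iio 0)) hopen (hconv.linear_image L) hdisj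
  have hu : u ≤ 0 := by simpa using hf2 (L 0) ⟨0, Matrix.PosSemidef.zero, rfl⟩
  have hcone : ∀ Y : Matrix ι ι ℝ, Y.PosSemidef → 0 ≤ f (L Y) := by
    intro Y hY
    by_contra! hneg
    have h1 := hf2 (L (((u - 1) / f (L Y)) • Y))
      ⟨_, hY.smul (div_nonneg_of_nonpos (by linarith) hneg.le), rfl⟩
    rw [map_smul, map_smul, smul_eq_mul, div_mul_cancel₀ _ hneg.ne] at h1
    linarith
  -- By continuity the functional is nonpositive on the closed orthant.
  have hcl : ∀ (a : ℝ) (b : τ → ℝ), 0 ≤ a → (∀ i, b i ≤ 0) → f (a, b) ≤ 0 := by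
    intro a b ha hb
    have h1 : ∀ ε : ℝ, 0 < ε → f (a, b) + ε * f (1, fun _ => -1) ≤ 0 := by
      intro ε hε
      rw [← smul_eq_mul, ← map_smul, ← map_add]
      refine ((hf1 _ ⟨?_, fun i _ => ?_⟩).trans_le hu).le
      · simp; linarith
      · have := hb i; simp; linarith
    by_contra! hc
    rcases le_or_gt 0 (f (1, fun _ => -1)) with h2 | h2
    · have := h1 1 one_pos; linarith
    · have := h1 (f (a, b) / 2 / (-f (1, fun _ => -1))) (by apply div_pos <;> linarith)
      rw [div_mul_eq_mul_div, div_neg, mul_div_assoc, div_self h2.ne] at this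
      linarith
  set α : ℝ := f (1, 0)
  set β : τ → ℝ := fun i => f (0, Pi.single i 1)
  have hf : ∀ (a : ℝ) (b : τ → ℝ), f (a, b) = a * α + ∑ i, b i * β i := by
    intro a b
    have h1 : ((a, b) : ℝ × (τ → ℝ)) = a • ((1, 0) : ℝ × (τ → ℝ))
        + ∑ i, b i • ((0, Pi.single i 1) : ℝ × (τ → ℝ)) := by
      ext i
      · simp [Prod.fst_sum]
      · simp [Prod.snd_sum, Finset.sum_apply, Pi.single_apply]
    rw [h1, map_add, map_smul, map_sum]
    simp only [map_smul, smul_eq_mul]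
    rfl
  have hα0 : α ≤ 0 := hcl 1 0 zero_le_one fun i => le_rfl
  have hβ0 : ∀ i, 0 ≤ β i := by
    intro i
    have h1 := hcl 0 (-Pi.single i 1) le_rfl fun j => by
      by_cases hij : j = i
      · subst hij; simp
      · simp [hij]
    have h2 : ((0 : ℝ), (-Pi.single i 1 : τ → ℝ)) = -((0, Pi.single i 1) : ℝ × (τ → ℝ)) := by
      ext <;> simp
    rw [h2, map_neg] at h1
    simpa using h1
  -- If the objective had multiplier zero, the Slater point would force `f = 0`.
  have hα1 : α < 0 := by
    refine lt_of_le_of_ne hα0 fun hzero => ?_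
    have h1 := hcone Y₀ hY₀
    have h2 : f (L Y₀) = ∑ i, (A i * Y₀).trace * β i := by
      change f (_, _) = _
      rw [hf, hzero]; simp
    have h3 : ∀ i ∈ Finset.univ, (A i * Y₀).trace * β i ≤ 0 := fun i _ =>
      mul_nonpos_of_nonpos_of_nonneg (hslater i).le (hβ0 i)
    have h4 := (Finset.sum_eq_zero_iff_of_nonpos h3).1
      (le_antisymm (Finset.sum_nonpos h3) (h2 ▸ h1))
    have h5 := hf1 (1, fun _ => -1) ⟨by simp, fun i _ => by simp⟩
    rw [hf, hzero] at h5
    have h6 : ∀ i, β i = 0 := fun i =>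
      (mul_eq_zero.1 (h4 i (Finset.mem_univ i))).resolve_left (hslater i).ne
    simp [h6] at h5
    linarith
  refine ⟨fun i => β i / (-α), fun i => div_nonneg (hβ0 i) (by linarith), fun v => ?_⟩
  -- Rank-one matrices turn the trace inequality into one of quadratic forms.
  have h1 := hcone (Matrix.vecMulVec v v) (by simpa using Matrix.posSemidef_vecMulVec_self_star v)
  have h2 : ∀ K : Matrix ι ι ℝ, (K * Matrix.vecMulVec v v).trace = v ⬝ᵥ K *ᵥ v := by
    intro K
    rw [Matrix.mul_vecMulVec, Matrix.trace_vecMulVec, dotProduct_comm]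
  change 0 ≤ f (_, _) at h1
  rw [hf] at h1
  simp only [h2] at h1
  have h3 : ∑ i, β i / (-α) * (v ⬝ᵥ A i *ᵥ v) = (∑ i, (v ⬝ᵥ A i *ᵥ v) * β i) / (-α) := by
    rw [Finset.sum_div]
    refine Finset.sum_congr rfl fun i _ => ?_
    ring
  rw [h3, le_div_iff₀ (by linarith)]
  linarith

end Relaxation

section Certificate

open scoped RealInnerProductSpace

lemma PosSemidef.exists_eq_gram {ι : Type*} [Fintype ι] {Y : Matrix ι ι ℝ} (hY : Y.PosSemidef) :
    ∃ l : ι → EuclideanSpace ℝ ι, Y = Matrix.gram ℝ l := by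
  classical
  refine ⟨fun a => WithLp.toLp 2 (CFC.sqrt Y a), ?_⟩
  ext a b
  have hsymm : ∀ c, CFC.sqrt Y c b = CFC.sqrt Y b c := fun c =>
    congr_fun₂ (transpose_sqrt Y) b c
  conv_lhs => rw [← sqrt_mul_sqrt_of_posSemidef hY, Matrix.mul_apply]
  rw [Matrix.gram_apply, PiLp.inner_apply]
  exact Finset.sum_congr rfl fun c _ => by simp [hsymm, mul_comm]

lemma trace_mul_gram {ι E : Type*} [Fintype ι] [NormedAddCommGroup E] [InnerProductSpace ℝ E]
    (K : Matrix ι ι ℝ) (l : ι → E) :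
    (K * Matrix.gram ℝ l).trace = ∑ a, ∑ b, K a b * ⟪l a, l b⟫ := by
  rw [Matrix.trace]
  refine Finset.sum_congr rfl fun a _ => ?_
  rw [Matrix.diag_apply, Matrix.mul_apply]
  refine Finset.sum_congr rfl fun b _ => ?_
  rw [Matrix.gram_apply, real_inner_comm]

lemma LTVSystem.sum_bigP_mul {p T : ℕ} (P : Matrix (Fin p) (Fin p) ℝ) (i : Fin T)
    (F : DistIdx p T → DistIdx p T → ℝ) :
    ∑ x, ∑ y, LTVSystem.bigP P i x y * F x y = ∑ a, ∑ b, P a b * F (a, i) (b, i) := by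
  simp only [Fintype.sum_prod_type, LTVSystem.bigP, Matrix.blockDiagonal_apply, ite_mul, zero_mul]
  refine Finset.sum_congr rfl fun a _ => ?_
  rw [Finset.sum_eq_single i]
  · refine Finset.sum_congr rfl fun b _ => ?_
    simp
  · intro j _ hj
    simp [Pi.single_eq_of_ne hj]
  · simp

/-- The matrix of the quadratic form `w_iᵀ P w_i - t²` in `(t, w)`. -/
def ellipsoidForm {p T : ℕ} (P : Matrix (Fin p) (Fin p) ℝ) (i : Fin T) :
    Matrix (Unit ⊕ DistIdx p T) (Unit ⊕ DistIdx p T) ℝ :=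
  Matrix.fromBlocks (-1) 0 0 (LTVSystem.bigP P i)

lemma sum_ellipsoidForm_mul {p T : ℕ} (P : Matrix (Fin p) (Fin p) ℝ) (i : Fin T)
    (F : Unit ⊕ DistIdx p T → Unit ⊕ DistIdx p T → ℝ) :
    ∑ x, ∑ y, ellipsoidForm P i x y * F x y
      = ∑ a, ∑ b, P a b * F (Sum.inr (a, i)) (Sum.inr (b, i)) - F (Sum.inl ()) (Sum.inl ()) := by
  rw [← LTVSystem.sum_bigP_mul P i fun x y => F (Sum.inr x) (Sum.inr y)]
  simp [ellipsoidForm, Fintype.sum_sum_type, neg_add_eq_sub]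

lemma dotProduct_ellipsoidForm_mulVec {p T : ℕ} (P : Matrix (Fin p) (Fin p) ℝ) (i : Fin T)
    (v : Unit ⊕ DistIdx p T → ℝ) :
    v ⬝ᵥ ellipsoidForm P i *ᵥ v = block v i ⬝ᵥ P *ᵥ block v i - v (Sum.inl ()) ^ 2 := by
  rw [dotProduct_mulVec_eq_sum, sum_ellipsoidForm_mul, dotProduct_mulVec_eq_sum, sq]

/-- A bound of `M` by `μ N` on the product of ellipsoids becomes a certificate with multipliers
once the level is raised by the factor `(π / 2) (s₂ / s₁)`. -/
theorem exists_multipliers_of_bound {p T : ℕ} {P : Matrix (Fin p) (Fin p) ℝ} (hP : P.PosDef)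
    {M N : Matrix (Unit ⊕ DistIdx p T) (Unit ⊕ DistIdx p T) ℝ} (hM : M.PosSemidef)
    {D : Unit ⊕ DistIdx p T → ℝ} {s₁ s₂ μ : ℝ} (hs₁ : 0 < s₁) (hs₂ : 0 ≤ s₂) (hμ : 0 ≤ μ)
    (hN₁ : ∀ v : Unit ⊕ DistIdx p T → ℝ, s₁ * ∑ a, D a * v a ^ 2 ≤ v ⬝ᵥ N *ᵥ v)
    (hN₂ : ∀ v : Unit ⊕ DistIdx p T → ℝ, v ⬝ᵥ N *ᵥ v ≤ s₂ * ∑ a, D a * v a ^ 2)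
    (hMN : ∀ v : Unit ⊕ DistIdx p T → ℝ,
      (∀ i, block v i ⬝ᵥ P *ᵥ block v i ≤ v (Sum.inl ()) ^ 2) →
      v ⬝ᵥ M *ᵥ v ≤ μ * (v ⬝ᵥ N *ᵥ v)) :
    ∃ lam : Fin T → ℝ, (∀ i, 0 ≤ lam i) ∧ ∀ v : Unit ⊕ DistIdx p T → ℝ,
      v ⬝ᵥ M *ᵥ v ≤ Real.pi / 2 * (s₂ / s₁) * μ * (v ⬝ᵥ N *ᵥ v)
        + ∑ i, lam i * (block v i ⬝ᵥ P *ᵥ block v i - v (Sum.inl ()) ^ 2) := by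
  set c := Real.pi / 2 * (s₂ / s₁) * μ with hc
  have hc0 : 0 ≤ c := by positivity
  have htr : ∀ Y : Matrix (Unit ⊕ DistIdx p T) (Unit ⊕ DistIdx p T) ℝ, Y.PosSemidef →
      (∀ i, (ellipsoidForm P i * Y).trace < 0) → ((M - c • N) * Y).trace ≤ 0 := by
    intro Y hY hneg
    obtain ⟨l, rfl⟩ := PosSemidef.exists_eq_gram hY
    have hl : ∀ i, ∑ a, ∑ b, P a b * ⟪l (Sum.inr (a, i)), l (Sum.inr (b, i))⟫
        ≤ ⟪l (Sum.inl ()), l (Sum.inl ())⟫ := by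
      intro i
      have h1 := hneg i
      rw [trace_mul_gram, sum_ellipsoidForm_mul P i fun x y => ⟪l x, l y⟫] at h1
      linarith
    have h1 := sum_mul_inner_le_of_bound hP hM hμ hN₂ hMN l hl
    have h2 : s₁ * ∑ a, D a * ⟪l a, l a⟫ ≤ ∑ a, ∑ b, N a b * ⟪l a, l b⟫ := by
      have h3 : ∀ e : Unit ⊕ DistIdx p T, s₁ * ∑ a, D a * (l a e) ^ 2
          ≤ ∑ a, ∑ b, N a b * (l a e * l b e) := fun e => by
        rw [← dotProduct_mulVec_eq_sum N (fun a => l a e) fun a => l a e]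
        exact hN₁ fun a => l a e
      have h4 := Finset.sum_le_sum fun e (_ : e ∈ Finset.univ) => h3 e
      have h5 : ∀ a b, ⟪l a, l b⟫ = ∑ e, l a e * l b e := fun a b => by
        rw [PiLp.inner_apply]
        exact Finset.sum_congr rfl fun e _ => by simp [mul_comm]
      rw [← Finset.mul_sum, Finset.sum_comm] at h4
      simp_rw [h5, Finset.mul_sum, ← sq]
      simp_rw [Finset.mul_sum] at h4
      refine h4.trans_eq ?_
      rw [Finset.sum_comm]
      exact Finset.sum_congr rfl fun a _ => Finset.sum_comm
    rw [trace_mul_gram]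
    simp only [Matrix.sub_apply, Matrix.smul_apply, smul_eq_mul, sub_mul, Finset.sum_sub_distrib,
      mul_assoc c, ← Finset.mul_sum]
    have h6 : Real.pi / 2 * (μ * (s₂ * ∑ a, D a * ⟪l a, l a⟫))
        = c * (s₁ * ∑ a, D a * ⟪l a, l a⟫) := by
      rw [hc]; field_simp
    have h7 := mul_le_mul_of_nonneg_left h2 hc0
    linarith
  -- The Slater point is the rank-one matrix of `t = 1`, `w = 0`.
  obtain ⟨lam, hlam, h⟩ := exists_multipliers (M - c • N) (ellipsoidForm P)
    (Matrix.posSemidef_gram ℝ (Sum.elim (fun _ => (1 : ℝ)) fun _ => 0)) (fun i => by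
      rw [trace_mul_gram, sum_ellipsoidForm_mul P i fun x y =>
        ⟪(Sum.elim (fun _ => (1 : ℝ)) fun _ => 0 : Unit ⊕ DistIdx p T → ℝ) x,
          (Sum.elim (fun _ => (1 : ℝ)) fun _ => 0 : Unit ⊕ DistIdx p T → ℝ) y⟫]
      simp) htr
  refine ⟨lam, hlam, fun v => ?_⟩
  have h1 := h v
  simp only [Matrix.sub_mulVec, dotProduct_sub, Matrix.smul_mulVec, dotProduct_smul, smul_eq_mul,
    dotProduct_ellipsoidForm_mulVec] at h1
  linarith

end Certificate

/-! ### Extreme singular values of a positive definite matrix -/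

section Cond

variable {ι : Type*} [Fintype ι] [DecidableEq ι]

open scoped RealInnerProductSpace

lemma toEuclideanLin_eigenvectorBasis {W : Matrix ι ι ℝ} (hW : W.IsHermitian) (j : ι) :
    Matrix.toEuclideanLin W (hW.eigenvectorBasis j)
      = hW.eigenvalues j • hW.eigenvectorBasis j := by
  rw [Matrix.toLpLin_apply]
  ext i
  exact congr_fun (hW.mulVec_eigenvectorBasis j) i

/-- For a symmetric matrix the squares of the eigenvalues are the squares of the singular values, so
the largest and the smallest singular value bound the eigenvalues. -/
lemma PosDef.eigenvalues_mem_Icc [Nonempty ι] {W : Matrix ι ι ℝ} (hW : W.PosDef) (j : ι) :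
    hW.1.eigenvalues j ∈ Set.Icc
      ((Matrix.toEuclideanLin W).singularValues (Fintype.card ι - 1))
      ((Matrix.toEuclideanLin W).singularValues 0) := by
  set A := Matrix.toEuclideanLin W with hA
  have hpos := hW.eigenvalues_pos j
  have hadj : A.adjoint = A := by
    rw [hA, ← Matrix.toEuclideanLin_conjTranspose_eq_adjoint, hW.1]
  have hev : Module.End.HasEigenvalue (A.adjoint ∘ₗ A) (hW.1.eigenvalues j ^ 2) := by
    refine Module.End.hasEigenvalue_of_hasEigenvector
      (x := hW.1.eigenvectorBasis j) ⟨?_, hW.1.eigenvectorBasis.orthonormal.ne_zero j⟩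
    have h1 := toEuclideanLin_eigenvectorBasis hW.1 j
    rw [← hA] at h1
    rw [Module.End.mem_eigenspace_iff, LinearMap.comp_apply, hadj, h1, map_smul, h1, smul_smul, sq]
  obtain ⟨i, hi⟩ := A.isSymmetric_adjoint_comp_self.exists_eigenvalues_eq rfl hev
  have hs : A.singularValues i = hW.1.eigenvalues j := by
    rw [A.singularValues_fin rfl]
    have h2 : A.isSymmetric_adjoint_comp_self.eigenvalues rfl i = hW.1.eigenvalues j ^ 2 := by
      exact_mod_cast hi
    rw [h2, Real.sqrt_sq hpos.le]
  have hcard : Module.finrank ℝ (EuclideanSpace ℝ ι) = Fintype.card ι := finrank_euclideanSpace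
  have hlt := i.isLt
  rw [← hs]
  exact ⟨A.singularValues_antitone (by omega), A.singularValues_antitone (Nat.zero_le _)⟩

lemma PosDef.singularValues_pos [Nonempty ι] {W : Matrix ι ι ℝ} (hW : W.PosDef) :
    0 < (Matrix.toEuclideanLin W).singularValues (Fintype.card ι - 1) := by
  have hinj : Function.Injective (Matrix.toEuclideanLin W) := by
    rw [injective_iff_map_eq_zero]
    intro v hv
    have h1 := Matrix.mulVec_injective_iff_isUnit.2 hW.isUnit
    rw [Matrix.toLpLin_apply] at hv
    have h2 : W *ᵥ WithLp.ofLp v = W *ᵥ 0 := by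
      rw [Matrix.mulVec_zero]
      ext i
      exact congr_fun (congr_arg WithLp.ofLp hv) i
    ext i
    exact congr_fun (h1 h2) i
  refine ((Matrix.toEuclideanLin W).injective_iff_forall_lt_finrank_singularValues_pos.1 hinj) _ ?_
  rw [finrank_euclideanSpace]
  have := Fintype.card_pos (α := ι)
  omega

lemma IsHermitian.dotProduct_mulVec_eq_sum_eigenvalues {W : Matrix ι ι ℝ} (hW : W.IsHermitian)
    (v : ι → ℝ) :
    v ⬝ᵥ W *ᵥ v = ∑ j, hW.eigenvalues j * ⟪hW.eigenvectorBasis j, WithLp.toLp 2 v⟫ ^ 2 := by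
  set A := Matrix.toEuclideanLin W with hA
  have h1 : v ⬝ᵥ W *ᵥ v = ⟪WithLp.toLp 2 v, A (WithLp.toLp 2 v)⟫ := by
    rw [hA, Matrix.toLpLin_apply, PiLp.inner_apply, dotProduct]
    exact Finset.sum_congr rfl fun i _ => by simp [mul_comm]
  rw [h1, ← hW.eigenvectorBasis.sum_inner_mul_inner]
  refine Finset.sum_congr rfl fun j _ => ?_
  have hsym : A.IsSymmetric := Matrix.isSymmetric_toEuclideanLin_iff.2 hW
  rw [← hsym, hA, toEuclideanLin_eigenvectorBasis, real_inner_smul_left, real_inner_comm]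
  ring

lemma sum_sq_eq_sum_inner_sq {W : Matrix ι ι ℝ} (hW : W.IsHermitian) (v : ι → ℝ) :
    ∑ a, v a ^ 2 = ∑ j, ⟪hW.eigenvectorBasis j, WithLp.toLp 2 v⟫ ^ 2 := by
  rw [hW.eigenvectorBasis.sum_sq_inner_right, EuclideanSpace.real_norm_sq_eq]

lemma PosDef.singularValue_mul_le_dotProduct [Nonempty ι] {W : Matrix ι ι ℝ} (hW : W.PosDef)
    (v : ι → ℝ) :
    (Matrix.toEuclideanLin W).singularValues (Fintype.card ι - 1) * ∑ a, v a ^ 2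
      ≤ v ⬝ᵥ W *ᵥ v := by
  rw [IsHermitian.dotProduct_mulVec_eq_sum_eigenvalues hW.1, sum_sq_eq_sum_inner_sq hW.1,
    Finset.mul_sum]
  exact Finset.sum_le_sum fun j _ =>
    mul_le_mul_of_nonneg_right (PosDef.eigenvalues_mem_Icc hW j).1 (sq_nonneg _)

lemma PosDef.dotProduct_le_singularValue_mul [Nonempty ι] {W : Matrix ι ι ℝ} (hW : W.PosDef)
    (v : ι → ℝ) :
    v ⬝ᵥ W *ᵥ v ≤ (Matrix.toEuclideanLin W).singularValues 0 * ∑ a, v a ^ 2 := by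
  rw [IsHermitian.dotProduct_mulVec_eq_sum_eigenvalues hW.1, sum_sq_eq_sum_inner_sq hW.1,
    Finset.mul_sum]
  exact Finset.sum_le_sum fun j _ =>
    mul_le_mul_of_nonneg_right (PosDef.eigenvalues_mem_Icc hW j).2 (sq_nonneg _)

lemma condNumber_pos [Nonempty ι] {W : Matrix ι ι ℝ} (hW : W.PosDef) : 0 < condNumber W := by
  have h1 := PosDef.singularValues_pos hW
  have h2 := (Matrix.toEuclideanLin W).singularValues_antitone
    (Nat.zero_le (Fintype.card ι - 1))
  exact div_pos (h1.trans_le h2) h1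

end Cond

lemma dotProduct_transpose_mul_mul_mulVec {α β : Type*} [Fintype α] [Fintype β]
    (M : Matrix α β ℝ) (K : Matrix α α ℝ) (v : β → ℝ) :
    v ⬝ᵥ (Mᵀ * K * M) *ᵥ v = (M *ᵥ v) ⬝ᵥ K *ᵥ (M *ᵥ v) := by
  rw [Matrix.mul_assoc, ← Matrix.mulVec_mulVec, Matrix.dotProduct_mulVec, Matrix.vecMul_transpose,
    Matrix.mulVec_mulVec]

namespace LTVSystem

variable {n m p T : ℕ} (S : LTVSystem n m p T)

/-! ### Causality and the stacked dynamics -/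

lemma shift_mulVec_zero (x : StateIdx n T → ℝ) (a : Fin n) : (shift n T *ᵥ x) (a, 0) = 0 := by
  simp [Matrix.mulVec, dotProduct, shift]

lemma shift_mulVec_succ (x : StateIdx n T → ℝ) (a : Fin n) (k : Fin T) :
    (shift n T *ᵥ x) (a, k.succ) = x (a, k.castSucc) := by
  rw [Matrix.mulVec, dotProduct, Finset.sum_eq_single (a, k.castSucc)]
  · simp [shift]
  · rintro ⟨b, j⟩ _ hne
    have : ¬(a = b ∧ (k.succ : ℕ) = (j : ℕ) + 1) := by
      rintro ⟨rfl, hj⟩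
      apply hne
      ext
      · rfl
      · simp at hj ⊢; omega
    simp only [shift, Matrix.of_apply, if_neg this, zero_mul]
  · simp

/-- A block lower triangular matrix becomes strictly block lower triangular after a downshift. -/
lemma shift_mul_apply_eq_zero {L : Matrix (StateIdx n T) (StateIdx n T) ℝ}
    (hL : ∀ a k b j, k < j → L (a, k) (b, j) = 0) (a : Fin n) (k : Fin (T + 1)) (b : Fin n)
    (j : Fin (T + 1)) (hkj : k ≤ j) : (shift n T * L) (a, k) (b, j) = 0 := by
  have h : (shift n T * L) (a, k) (b, j) = (shift n T *ᵥ L.col (b, j)) (a, k) := rfl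
  rw [h]
  refine Fin.cases (fun _ => shift_mulVec_zero _ _) (fun i hi => ?_) k hkj
  rw [shift_mulVec_succ]
  exact hL _ _ _ _ (lt_of_lt_of_le i.castSucc_lt_succ hi)

/-- Solving with a unipotent causal matrix preserves vanishing up to a given time. -/
lemma eq_zero_of_one_sub_mulVec {L : Matrix (StateIdx n T) (StateIdx n T) ℝ}
    (hL : ∀ a k b j, k ≤ j → L (a, k) (b, j) = 0) {x : StateIdx n T → ℝ} (k : Fin (T + 1))
    (hx : ∀ j ≤ k, ∀ a, ((1 - L) *ᵥ x) (a, j) = 0) (a : Fin n) : x (a, k) = 0 := by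
  induction k using WellFoundedLT.induction generalizing a with
  | ind k ih =>
    have h1 := hx k le_rfl a
    rw [Matrix.sub_mulVec, Matrix.one_mulVec, Pi.sub_apply, sub_eq_zero] at h1
    rw [h1]
    refine Finset.sum_eq_zero fun c _ => ?_
    obtain ⟨b, j⟩ := c
    rcases lt_or_ge j k with hj | hj
    · rw [ih j hj (fun i hi => hx i (hi.trans hj.le)) b, mul_zero]
    · exact mul_eq_zero_of_left (hL a k b j hj) _

lemma isUnit_one_sub {L : Matrix (StateIdx n T) (StateIdx n T) ℝ}
    (hL : ∀ a k b j, k ≤ j → L (a, k) (b, j) = 0) : IsUnit (1 - L) := by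
  rw [← Matrix.mulVec_injective_iff_isUnit, ← Matrix.coe_mulVecLin, injective_iff_map_eq_zero]
  intro x hx
  ext ⟨a, k⟩
  exact eq_zero_of_one_sub_mulVec hL k (fun j _ b => congr_fun hx (b, j)) a

lemma bigA_apply_eq_zero (a : Fin n) (k : Fin (T + 1)) (b : Fin n) (j : Fin (T + 1)) (h : k < j) :
    S.bigA (a, k) (b, j) = 0 :=
  Matrix.blockDiagonal_apply_ne _ _ _ h.ne

lemma isUnit_det_one_sub_shift_mul_bigA : IsUnit (1 - shift n T * S.bigA).det :=
  (Matrix.isUnit_iff_isUnit_det _).1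
    (isUnit_one_sub (shift_mul_apply_eq_zero S.bigA_apply_eq_zero))

lemma blockDiagonal_mulVec_apply {α β τ : Type*} [Fintype β] [Fintype τ] [DecidableEq τ]
    (M : τ → Matrix α β ℝ) (x : β × τ → ℝ) (a : α) (k : τ) :
    (Matrix.blockDiagonal M *ᵥ x) (a, k) = (M k *ᵥ fun b => x (b, k)) a := by
  simp [Matrix.mulVec, dotProduct, Fintype.sum_prod_type, Matrix.blockDiagonal_apply]

lemma bigE_mulVec_zero (δ : DeltaIdx n p T → ℝ) (a : Fin n) :
    (S.bigE *ᵥ δ) (a, 0) = δ (Sum.inl a) := by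
  simp [Matrix.mulVec, dotProduct, bigE, (Fin.succ_ne_zero _).symm]

lemma bigE_mulVec_succ (δ : DeltaIdx n p T → ℝ) (a : Fin n) (k : Fin T) :
    (S.bigE *ᵥ δ) (a, k.succ) = (S.E k *ᵥ fun b => δ (Sum.inr (b, k))) a := by
  simp [Matrix.mulVec, dotProduct, bigE, Fintype.sum_prod_type]

/-- The stacked state sequence. -/
def stackedState (δ : DeltaIdx n p T → ℝ) (u : InputIdx m T → ℝ) : StateIdx n T → ℝ :=
  fun i => S.state δ u i.2 i.1

lemma one_sub_shift_mul_bigA_mulVec_stackedState (δ : DeltaIdx n p T → ℝ)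
    (u : InputIdx m T → ℝ) :
    (1 - shift n T * S.bigA) *ᵥ S.stackedState δ u
      = (shift n T * S.bigB) *ᵥ u + S.bigE *ᵥ δ := by
  rw [Matrix.sub_mulVec, Matrix.one_mulVec, ← Matrix.mulVec_mulVec, ← Matrix.mulVec_mulVec,
    sub_eq_iff_eq_add]
  ext ⟨a, k⟩
  refine Fin.cases ?_ (fun j => ?_) k
  · simp only [Pi.add_apply, shift_mulVec_zero, bigE_mulVec_zero]
    simp [stackedState, state]
  · simp only [Pi.add_apply, shift_mulVec_succ, bigE_mulVec_succ, bigA, bigB,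
      blockDiagonal_mulVec_apply]
    simp only [stackedState, state, Fin.induction_succ, Pi.add_apply]
    ring

lemma stackedState_unique {δ : DeltaIdx n p T → ℝ} {u : InputIdx m T → ℝ}
    {x : StateIdx n T → ℝ}
    (hx : (1 - shift n T * S.bigA) *ᵥ x = (shift n T * S.bigB) *ᵥ u + S.bigE *ᵥ δ) :
    S.stackedState δ u = x :=
  Matrix.mulVec_injective_iff_isUnit.2
    ((Matrix.isUnit_iff_isUnit_det _).2 S.isUnit_det_one_sub_shift_mul_bigA)
    ((S.one_sub_shift_mul_bigA_mulVec_stackedState δ u).trans hx.symm)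

lemma stackedState_eq (δ : DeltaIdx n p T → ℝ) (u : InputIdx m T → ℝ) :
    S.stackedState δ u = S.opF *ᵥ u + S.opG *ᵥ δ := by
  apply S.stackedState_unique
  rw [Matrix.mulVec_add, Matrix.mulVec_mulVec, Matrix.mulVec_mulVec, opF, opG,
    Matrix.mul_nonsing_inv_cancel_left _ _ S.isUnit_det_one_sub_shift_mul_bigA,
    Matrix.mul_nonsing_inv_cancel_left _ _ S.isUnit_det_one_sub_shift_mul_bigA]

lemma dotProduct_blockDiagonal_mulVec {α τ : Type*} [Fintype α] [Fintype τ] [DecidableEq τ]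
    (M : τ → Matrix α α ℝ) (x : α × τ → ℝ) :
    x ⬝ᵥ Matrix.blockDiagonal M *ᵥ x = ∑ k, (fun a => x (a, k)) ⬝ᵥ M k *ᵥ fun a => x (a, k) := by
  rw [dotProduct, Fintype.sum_prod_type, Finset.sum_comm]
  simp only [blockDiagonal_mulVec_apply]
  rfl

lemma cost_eq (δ : DeltaIdx n p T → ℝ) (u : InputIdx m T → ℝ) :
    S.cost δ u = S.stackedState δ u ⬝ᵥ S.bigQ *ᵥ S.stackedState δ u + u ⬝ᵥ S.bigR *ᵥ u := by
  rw [bigQ, bigR, dotProduct_blockDiagonal_mulVec, dotProduct_blockDiagonal_mulVec, cost,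
    Finset.sum_add_distrib]
  rfl

variable {S}

lemma bigQ_posSemidef (hQ : ∀ k, (S.Q k).PosSemidef) : S.bigQ.PosSemidef := by
  refine Matrix.PosSemidef.of_dotProduct_mulVec_nonneg ?_ fun x => ?_
  · rw [Matrix.IsHermitian, bigQ, Matrix.blockDiagonal_conjTranspose]
    exact congr_arg _ (funext fun k => (hQ k).1)
  · rw [star_trivial, bigQ, dotProduct_blockDiagonal_mulVec]
    exact Finset.sum_nonneg fun k _ => by simpa using (hQ k).dotProduct_mulVec_nonneg _

lemma bigR_posDef (hR : ∀ k, (S.R k).PosDef) : S.bigR.PosDef := by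
  refine Matrix.PosDef.of_dotProduct_mulVec_pos ?_ fun x hx => ?_
  · rw [Matrix.IsHermitian, bigR, Matrix.blockDiagonal_conjTranspose]
    exact congr_arg _ (funext fun k => (hR k).1)
  · rw [star_trivial, bigR, dotProduct_blockDiagonal_mulVec]
    obtain ⟨⟨a, k⟩, hak⟩ := Function.ne_iff.1 hx
    refine Finset.sum_pos' (fun k _ => by
      simpa using (hR k).posSemidef.dotProduct_mulVec_nonneg _) ⟨k, Finset.mem_univ k, ?_⟩
    have h1 : (fun a => x (a, k)) ≠ 0 := fun h => hak (congr_fun h a)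
    simpa using (hR k).dotProduct_mulVec_pos h1

lemma bigC_posSemidef (hQ : ∀ k, (S.Q k).PosSemidef) (hR : ∀ k, (S.R k).PosDef) :
    S.bigC.PosSemidef := by
  refine Matrix.PosSemidef.of_dotProduct_mulVec_nonneg ?_ fun x => ?_
  · rw [Matrix.IsHermitian, bigC, Matrix.fromBlocks_conjTranspose, (bigQ_posSemidef hQ).1,
      (bigR_posDef hR).1]
    simp
  · rw [star_trivial, bigC, Matrix.fromBlocks_mulVec]
    have h1 := (bigQ_posSemidef hQ).dotProduct_mulVec_nonneg (x ∘ Sum.inl)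
    have h2 := (bigR_posDef hR).posSemidef.dotProduct_mulVec_nonneg (x ∘ Sum.inr)
    simp only [star_trivial] at h1 h2
    conv_rhs => rw [← Sum.elim_comp_inl_inr x]
    rw [sumElim_dotProduct_sumElim]
    simpa using add_nonneg h1 h2

/-! ### The optimal non-causal cost -/

variable (S)

/-- The Hessian `R + Fᵀ Q F` of the cost as a function of the inputs. -/
def inputHessian : Matrix (InputIdx m T) (InputIdx m T) ℝ := S.bigR + S.opFᵀ * S.bigQ * S.opF

variable {S}

lemma inputHessian_posDef (hQ : ∀ k, (S.Q k).PosSemidef) (hR : ∀ k, (S.R k).PosDef) :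
    S.inputHessian.PosDef := by
  have h := (bigQ_posSemidef hQ).conjTranspose_mul_mul_same S.opF
  rw [Matrix.conjTranspose_eq_transpose_of_trivial] at h
  exact (bigR_posDef hR).add_posSemidef h

/-- The push-through form of `O`, in which its symmetry and the completion of the square can be
read off. -/
lemma opO_eq (hQ : ∀ k, (S.Q k).PosSemidef) (hR : ∀ k, (S.R k).PosDef) :
    S.opO = S.opGᵀ * (S.bigQ - S.bigQ * S.opF * S.inputHessian⁻¹ * (S.opFᵀ * S.bigQ)) * S.opG := by
  have hRu := (Matrix.isUnit_iff_isUnit_det _).1 (bigR_posDef hR).isUnit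
  have hNu := (Matrix.isUnit_iff_isUnit_det _).1 (inputHessian_posDef hQ hR).isUnit
  have h1 : S.opFᵀ * S.bigQ * S.opF = S.inputHessian - S.bigR := by
    rw [inputHessian, add_sub_cancel_left]
  have hinv : (1 + S.opF * S.bigR⁻¹ * S.opFᵀ * S.bigQ)⁻¹
      = 1 - S.opF * S.inputHessian⁻¹ * (S.opFᵀ * S.bigQ) := by
    apply Matrix.inv_eq_right_inv
    have h2 : S.opF * S.bigR⁻¹ * S.opFᵀ * S.bigQ * (S.opF * S.inputHessian⁻¹ * (S.opFᵀ * S.bigQ))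
        = S.opF * S.bigR⁻¹ * (S.opFᵀ * S.bigQ * S.opF) * S.inputHessian⁻¹
          * (S.opFᵀ * S.bigQ) := by
      simp only [Matrix.mul_assoc]
    have h3 : S.opF * S.bigR⁻¹ * (S.inputHessian - S.bigR) * S.inputHessian⁻¹
        = S.opF * S.bigR⁻¹ - S.opF * S.inputHessian⁻¹ := by
      rw [Matrix.mul_sub, Matrix.sub_mul, Matrix.mul_nonsing_inv_cancel_right _ _ hNu,
        Matrix.nonsing_inv_mul_cancel_right _ _ hRu]
    rw [Matrix.mul_sub, Matrix.mul_one, Matrix.add_mul, Matrix.one_mul, h2, h1, h3, Matrix.sub_mul,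
      Matrix.mul_assoc (S.opF * S.bigR⁻¹)]
    abel
  rw [opO, hinv, Matrix.mul_assoc S.opGᵀ, Matrix.mul_sub, Matrix.mul_one]
  simp only [Matrix.mul_assoc]

lemma opO_transpose (hQ : ∀ k, (S.Q k).PosSemidef) (hR : ∀ k, (S.R k).PosDef) :
    S.opOᵀ = S.opO := by
  have hQt : S.bigQᵀ = S.bigQ := (bigQ_posSemidef hQ).1
  have hNt : S.inputHessianᵀ = S.inputHessian := (inputHessian_posDef hQ hR).1
  rw [opO_eq hQ hR]
  simp only [Matrix.transpose_mul, Matrix.transpose_sub, Matrix.transpose_transpose, hQt,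
    Matrix.transpose_nonsing_inv, hNt, Matrix.mul_assoc]

/-- Completion of the square in the inputs. -/
lemma cost_eq_opO_add (hQ : ∀ k, (S.Q k).PosSemidef) (hR : ∀ k, (S.R k).PosDef)
    (δ : DeltaIdx n p T → ℝ) (u : InputIdx m T → ℝ) :
    S.cost δ u = δ ⬝ᵥ S.opO *ᵥ δ
      + (u + S.inputHessian⁻¹ *ᵥ (S.opFᵀ * S.bigQ) *ᵥ S.opG *ᵥ δ) ⬝ᵥ S.inputHessian *ᵥ
        (u + S.inputHessian⁻¹ *ᵥ (S.opFᵀ * S.bigQ) *ᵥ S.opG *ᵥ δ) := by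
  have hQt : S.bigQᵀ = S.bigQ := (bigQ_posSemidef hQ).1
  have hNt : S.inputHessianᵀ = S.inputHessian := (inputHessian_posDef hQ hR).1
  have hNu := (Matrix.isUnit_iff_isUnit_det _).1 (inputHessian_posDef hQ hR).isUnit
  have hsymm : ∀ {ι : Type} [Fintype ι] (M : Matrix ι ι ℝ), Mᵀ = M → ∀ a b : ι → ℝ,
      a ⬝ᵥ M *ᵥ b = b ⬝ᵥ M *ᵥ a := fun M hM a b => by
    rw [Matrix.dotProduct_mulVec, ← Matrix.mulVec_transpose, hM, dotProduct_comm]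
  rw [cost_eq, stackedState_eq, opO_eq hQ hR]
  set y := S.opG *ᵥ δ with hy
  set q := (S.opFᵀ * S.bigQ) *ᵥ y with hq
  have h1 : δ ⬝ᵥ (S.opGᵀ * (S.bigQ - S.bigQ * S.opF * S.inputHessian⁻¹ * (S.opFᵀ * S.bigQ))
      * S.opG) *ᵥ δ = y ⬝ᵥ S.bigQ *ᵥ y - q ⬝ᵥ S.inputHessian⁻¹ *ᵥ q := by
    rw [dotProduct_transpose_mul_mul_mulVec, ← hy, Matrix.sub_mulVec, dotProduct_sub,
      ← Matrix.mulVec_mulVec, ← hq, ← Matrix.mulVec_mulVec,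
      Matrix.dotProduct_mulVec y (S.bigQ * S.opF), ← Matrix.mulVec_transpose,
      Matrix.transpose_mul, hQt, ← hq]
  have h2 : S.inputHessian *ᵥ S.inputHessian⁻¹ *ᵥ q = q := by
    rw [Matrix.mulVec_mulVec, Matrix.mul_nonsing_inv _ hNu, Matrix.one_mulVec]
  have h3 : u ⬝ᵥ S.inputHessian *ᵥ u
      = u ⬝ᵥ S.bigR *ᵥ u + (S.opF *ᵥ u) ⬝ᵥ S.bigQ *ᵥ S.opF *ᵥ u := by
    rw [inputHessian, Matrix.add_mulVec, dotProduct_add, dotProduct_transpose_mul_mul_mulVec]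
  have h4 : (S.opF *ᵥ u) ⬝ᵥ S.bigQ *ᵥ y = u ⬝ᵥ q := by
    rw [hq, ← Matrix.mulVec_mulVec, Matrix.dotProduct_mulVec u S.opFᵀ, Matrix.vecMul_transpose]
  rw [h1]
  simp only [Matrix.mulVec_add, dotProduct_add, add_dotProduct, h2]
  rw [hsymm _ hQt y (S.opF *ᵥ u), h4, h3, hsymm _ hNt (S.inputHessian⁻¹ *ᵥ q) u, h2,
    dotProduct_comm (S.inputHessian⁻¹ *ᵥ q) q]
  ring

lemma optCost_eq (hQ : ∀ k, (S.Q k).PosSemidef) (hR : ∀ k, (S.R k).PosDef)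
    (δ : DeltaIdx n p T → ℝ) : S.optCost δ = δ ⬝ᵥ S.opO *ᵥ δ := by
  have hle : ∀ u, δ ⬝ᵥ S.opO *ᵥ δ ≤ S.cost δ u := fun u => by
    rw [cost_eq_opO_add hQ hR]
    have := (inputHessian_posDef hQ hR).posSemidef.dotProduct_mulVec_nonneg
      (u + S.inputHessian⁻¹ *ᵥ (S.opFᵀ * S.bigQ) *ᵥ S.opG *ᵥ δ)
    rw [star_trivial] at this
    linarith
  refine le_antisymm ?_ (le_ciInf hle)
  refine (ciInf_le ⟨_, Set.forall_mem_range.2 hle⟩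
    (-(S.inputHessian⁻¹ *ᵥ (S.opFᵀ * S.bigQ) *ᵥ S.opG *ᵥ δ))).trans_eq ?_
  rw [cost_eq_opO_add hQ hR]
  simp

/-! ### Regret of a system response -/

variable (S)

/-- The matrix `Φᵀ C Φ - O` of the regret of a system response, as a quadratic form in `δ`. -/
def regretMatrix (Φ : Matrix (StateIdx n T ⊕ InputIdx m T) (DeltaIdx n p T) ℝ) :
    Matrix (DeltaIdx n p T) (DeltaIdx n p T) ℝ :=
  Φᵀ * S.bigC * Φ - S.opO

variable {S}

lemma IsResponse.stackedState_eq
    {Φ : Matrix (StateIdx n T ⊕ InputIdx m T) (DeltaIdx n p T) ℝ} (hΦ : S.IsResponse Φ)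
    (δ : DeltaIdx n p T → ℝ) : S.stackedState δ (Φ.toRows₂ *ᵥ δ) = Φ.toRows₁ *ᵥ δ := by
  apply S.stackedState_unique
  have h := hΦ.2
  rw [← Matrix.fromRows_toRows Φ, Matrix.fromCols_mul_fromRows, Matrix.neg_mul, ← sub_eq_add_neg,
    sub_eq_iff_eq_add'] at h
  rw [Matrix.mulVec_mulVec, h, Matrix.mulVec_mulVec, Matrix.add_mulVec]

lemma IsResponse.regret_eq (hQ : ∀ k, (S.Q k).PosSemidef) (hR : ∀ k, (S.R k).PosDef)
    {Φ : Matrix (StateIdx n T ⊕ InputIdx m T) (DeltaIdx n p T) ℝ} (hΦ : S.IsResponse Φ)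
    (δ : DeltaIdx n p T → ℝ) :
    S.cost δ (Φ.toRows₂ *ᵥ δ) - S.optCost δ = δ ⬝ᵥ S.regretMatrix Φ *ᵥ δ := by
  rw [optCost_eq hQ hR, regretMatrix, Matrix.sub_mulVec, dotProduct_sub, cost_eq,
    hΦ.stackedState_eq, dotProduct_transpose_mul_mul_mulVec]
  have h : Φ *ᵥ δ = Sum.elim (Φ.toRows₁ *ᵥ δ) (Φ.toRows₂ *ᵥ δ) := by
    conv_lhs => rw [← Matrix.fromRows_toRows Φ]
    rw [Matrix.fromRows_mulVec]
  rw [h, bigC, Matrix.fromBlocks_mulVec, sumElim_dotProduct_sumElim]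
  simp

lemma IsResponse.regretMatrix_posSemidef (hQ : ∀ k, (S.Q k).PosSemidef)
    (hR : ∀ k, (S.R k).PosDef) {Φ : Matrix (StateIdx n T ⊕ InputIdx m T) (DeltaIdx n p T) ℝ}
    (hΦ : S.IsResponse Φ) : (S.regretMatrix Φ).PosSemidef := by
  have hC : S.bigCᵀ = S.bigC := (bigC_posSemidef hQ hR).1
  refine Matrix.PosSemidef.of_dotProduct_mulVec_nonneg ?_ fun δ => ?_
  · rw [Matrix.IsHermitian, Matrix.conjTranspose_eq_transpose_of_trivial, regretMatrix,
      Matrix.transpose_sub, opO_transpose hQ hR, Matrix.transpose_mul, Matrix.transpose_mul,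
      Matrix.transpose_transpose, hC, Matrix.mul_assoc]
  · rw [star_trivial, ← hΦ.regret_eq hQ hR, cost_eq_opO_add hQ hR, optCost_eq hQ hR,
      add_sub_cancel_left]
    exact (inputHessian_posDef hQ hR).posSemidef.dotProduct_mulVec_nonneg _

/-! ### Closed loops are system responses -/

lemma bigA_add_bigB_mul_apply_eq_zero {K : Matrix (InputIdx m T) (StateIdx n T) ℝ}
    (hK : CausalGain K) (a : Fin n) (k : Fin (T + 1)) (b : Fin n) (j : Fin (T + 1)) (h : k < j) :
    (S.bigA + S.bigB * K) (a, k) (b, j) = 0 := by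
  rw [Matrix.add_apply, S.bigA_apply_eq_zero a k b j h, zero_add, Matrix.mul_apply]
  refine Finset.sum_eq_zero fun c _ => ?_
  obtain ⟨c, l⟩ := c
  by_cases hl : k = l
  · subst hl; rw [hK _ _ _ _ h, mul_zero]
  · rw [bigB, Matrix.blockDiagonal_apply_ne _ _ _ hl, zero_mul]

lemma exists_isResponse_of_causalGain {K : Matrix (InputIdx m T) (StateIdx n T) ℝ}
    (hK : CausalGain K) : ∃ Φ, S.IsResponse Φ ∧ Φ.toRows₂ = S.closedLoopInput K := by
  set L := shift n T * (S.bigA + S.bigB * K) with hLdef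
  have hL := shift_mul_apply_eq_zero (bigA_add_bigB_mul_apply_eq_zero (S := S) hK)
  have hu : IsUnit (1 - L).det := (Matrix.isUnit_iff_isUnit_det _).1 (isUnit_one_sub hL)
  set X : Matrix (StateIdx n T) (DeltaIdx n p T) ℝ := (1 - L)⁻¹ * S.bigE
  have hLX : (1 - L) * X = S.bigE := Matrix.mul_nonsing_inv_cancel_left _ _ hu
  have hcausal : ∀ (a : Fin n) (k : Fin (T + 1)) (b : Fin p) (j : Fin T), k ≤ j.castSucc →
      X (a, k) (Sum.inr (b, j)) = 0 := by
    intro a k b j hkj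
    refine eq_zero_of_one_sub_mulVec (x := X.col (Sum.inr (b, j))) hL k (fun i hi c => ?_) a
    have h1 : ((1 - L) *ᵥ X.col (Sum.inr (b, j))) (c, i)
        = ((1 - L) * X : Matrix _ _ ℝ) (c, i) (Sum.inr (b, j)) := rfl
    have h2 : i ≠ j.succ := (lt_of_le_of_lt (hi.trans hkj) j.castSucc_lt_succ).ne
    rw [h1, hLX]
    simp [bigE, h2]
  refine ⟨Matrix.fromRows X (K * X), ⟨⟨hcausal, fun a k b j hkj => ?_⟩, ?_⟩, ?_⟩
  · change (K * X) (a, k) (Sum.inr (b, j)) = 0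
    rw [Matrix.mul_apply]
    refine Finset.sum_eq_zero fun c _ => ?_
    obtain ⟨c, i⟩ := c
    rcases lt_or_ge k i with hi | hi
    · rw [hK _ _ _ _ hi, zero_mul]
    · rw [hcausal c i b j (hi.trans hkj), mul_zero]
  · rw [Matrix.fromCols_mul_fromRows, ← hLX, hLdef]
    simp only [Matrix.mul_add, Matrix.sub_mul, Matrix.add_mul, Matrix.neg_mul, Matrix.mul_assoc]
    abel
  · rw [Matrix.toRows₂_fromRows, closedLoopInput, Matrix.mul_assoc]

lemma feedbackLevels_subset_responseLevels (W : Matrix (DeltaIdx n p T) (DeltaIdx n p T) ℝ)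
    (P : Matrix (Fin p) (Fin p) ℝ) (x₀ : Fin n → ℝ) :
    S.feedbackLevels W P x₀ ⊆ S.responseLevels W P x₀ := by
  rintro μ ⟨K, hK, hμ⟩
  obtain ⟨Φ, hΦ, hu⟩ := exists_isResponse_of_causalGain (S := S) hK
  exact ⟨Φ, hΦ, by rwa [hu]⟩

/-! ### The linear matrix inequality as a quadratic inequality -/

/-- The matrix of the linear map `(t, w) ↦ (t x₀, w)`. -/
def liftMatrix (p T : ℕ) (x₀ : Fin n → ℝ) : Matrix (DeltaIdx n p T) (Unit ⊕ DistIdx p T) ℝ :=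
  Matrix.fromBlocks (Matrix.replicateCol Unit x₀) 0 0 1

lemma liftMatrix_mulVec (x₀ : Fin n → ℝ) (v : Unit ⊕ DistIdx p T → ℝ) :
    liftMatrix p T x₀ *ᵥ v = delta (v (Sum.inl ()) • x₀) (v ∘ Sum.inr) := by
  rw [liftMatrix, Matrix.fromBlocks_mulVec, delta]
  congr 1
  · ext a
    simp [Matrix.mulVec, dotProduct, mul_comm]
  · simp

lemma sum_liftMatrix_mulVec_sq (x₀ : Fin n → ℝ) (v : Unit ⊕ DistIdx p T → ℝ) :
    ∑ a, (liftMatrix p T x₀ *ᵥ v) a ^ 2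
      = ∑ a, Sum.elim (fun _ => ∑ b, x₀ b ^ 2) (fun _ => 1) a * v a ^ 2 := by
  rw [liftMatrix_mulVec]
  simp [delta, Fintype.sum_sum_type, mul_pow, ← Finset.mul_sum, mul_comm (∑ b, x₀ b ^ 2)]

/-- The part of the linear matrix inequality that involves the multipliers. -/
def multiplierMatrix (P : Matrix (Fin p) (Fin p) ℝ) (lam : Fin T → ℝ) :
    Matrix (Unit ⊕ DistIdx p T) (Unit ⊕ DistIdx p T) ℝ :=
  Matrix.fromBlocks (-((∑ i, lam i) • (1 : Matrix Unit Unit ℝ))) 0 0 (∑ i, lam i • bigP P i)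

lemma multiplierMatrix_eq (P : Matrix (Fin p) (Fin p) ℝ) (lam : Fin T → ℝ) :
    multiplierMatrix P lam = ∑ i, lam i • ellipsoidForm P i := by
  ext (a | a) (b | b) <;>
    simp [multiplierMatrix, ellipsoidForm, Matrix.sum_apply]

lemma dotProduct_multiplierMatrix_mulVec (P : Matrix (Fin p) (Fin p) ℝ) (lam : Fin T → ℝ)
    (v : Unit ⊕ DistIdx p T → ℝ) :
    v ⬝ᵥ multiplierMatrix P lam *ᵥ v
      = ∑ i, lam i * (block v i ⬝ᵥ P *ᵥ block v i - v (Sum.inl ()) ^ 2) := by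
  rw [multiplierMatrix_eq, Matrix.sum_mulVec, dotProduct_sum]
  exact Finset.sum_congr rfl fun i _ => by
    rw [Matrix.smul_mulVec, dotProduct_smul, dotProduct_ellipsoidForm_mulVec, smul_eq_mul]

lemma multiplierMatrix_transpose {P : Matrix (Fin p) (Fin p) ℝ} (hP : P.PosDef)
    (lam : Fin T → ℝ) : (multiplierMatrix P lam)ᵀ = multiplierMatrix P lam := by
  have hPt : Pᵀ = P := hP.1
  have h : ∀ i : Fin T, (bigP P i)ᵀ = bigP P i := fun i => by
    rw [bigP, Matrix.blockDiagonal_transpose]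
    congr 1
    ext1 j
    by_cases hj : j = i
    · subst hj; simp [hPt]
    · simp [Pi.single_eq_of_ne hj]
  simp [multiplierMatrix, Matrix.fromBlocks_transpose, Matrix.transpose_sum, h]

/-- The linear matrix inequality written with the lifted data. The lower left block of `O` and `W`
is the transpose of the upper right one because both matrices are symmetric. -/
lemma lmi_eq (hQ : ∀ k, (S.Q k).PosSemidef) (hR : ∀ k, (S.R k).PosDef)
    {W : Matrix (DeltaIdx n p T) (DeltaIdx n p T) ℝ} (hW : W.PosDef)
    (P : Matrix (Fin p) (Fin p) ℝ) (x₀ : Fin n → ℝ) (μ : ℝ) (lam : Fin T → ℝ)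
    (Φ : Matrix (StateIdx n T ⊕ InputIdx m T) (DeltaIdx n p T) ℝ) :
    S.lmi W P x₀ μ lam Φ = Matrix.fromBlocks
      ((liftMatrix p T x₀)ᵀ * (S.opO + μ • W) * liftMatrix p T x₀ + multiplierMatrix P lam)
      (CFC.sqrt S.bigC * Φ * liftMatrix p T x₀)ᵀ
      (CFC.sqrt S.bigC * Φ * liftMatrix p T x₀) 1 := by
  have hWt : Wᵀ = W := hW.1
  have hO₁₂ : S.opO.toBlocks₁₂ = S.opO.toBlocks₂₁ᵀ := by
    conv_lhs => rw [← opO_transpose hQ hR]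
    rfl
  have hW₁₂ : W.toBlocks₁₂ = W.toBlocks₂₁ᵀ := by
    conv_lhs => rw [← hWt]
    rfl
  have h1 : CFC.sqrt S.bigC * Φ * liftMatrix p T x₀ = Matrix.fromCols
      (CFC.sqrt S.bigC * Φ.toCols₁ * Matrix.replicateCol Unit x₀)
      (CFC.sqrt S.bigC * Φ.toCols₂) := by
    conv_lhs => rw [← Matrix.fromCols_toCols Φ]
    rw [Matrix.mul_fromCols, liftMatrix, Matrix.fromCols_mul_fromBlocks]
    simp
  have h2 : (liftMatrix p T x₀)ᵀ * (S.opO + μ • W) * liftMatrix p T x₀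
      = Matrix.fromBlocks
        ((Matrix.replicateCol Unit x₀)ᵀ * (S.opO.toBlocks₁₁ + μ • W.toBlocks₁₁)
          * Matrix.replicateCol Unit x₀)
        ((Matrix.replicateCol Unit x₀)ᵀ * (S.opO.toBlocks₂₁ᵀ + μ • W.toBlocks₂₁ᵀ))
        ((S.opO.toBlocks₂₁ + μ • W.toBlocks₂₁) * Matrix.replicateCol Unit x₀)
        (S.opO.toBlocks₂₂ + μ • W.toBlocks₂₂) := by
    conv_lhs => rw [← Matrix.fromBlocks_toBlocks S.opO, ← Matrix.fromBlocks_toBlocks W]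
    rw [hO₁₂, hW₁₂, liftMatrix, Matrix.fromBlocks_transpose, Matrix.fromBlocks_smul,
      Matrix.fromBlocks_add, Matrix.fromBlocks_multiply, Matrix.fromBlocks_multiply]
    simp
  have hst := transpose_sqrt S.bigC
  rw [lmi, h2, h1, multiplierMatrix, Matrix.fromBlocks_add, Matrix.transpose_fromCols]
  simp only [Matrix.transpose_mul, hst, Matrix.mul_assoc, add_zero, sub_eq_add_neg]
  congr 2
  abel

/-- By the Schur complement, feasibility means that `(t, w) ↦ δᵀ (μ W + O - Φᵀ C Φ) δ` with
`δ = (t x₀, w)` is bounded below by a combination of the ellipsoid constraints. -/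
lemma lmi_posSemidef_iff (hQ : ∀ k, (S.Q k).PosSemidef) (hR : ∀ k, (S.R k).PosDef)
    {W : Matrix (DeltaIdx n p T) (DeltaIdx n p T) ℝ} (hW : W.PosDef)
    {P : Matrix (Fin p) (Fin p) ℝ} (hP : P.PosDef) (x₀ : Fin n → ℝ) (μ : ℝ) (lam : Fin T → ℝ)
    (Φ : Matrix (StateIdx n T ⊕ InputIdx m T) (DeltaIdx n p T) ℝ) :
    (S.lmi W P x₀ μ lam Φ).PosSemidef ↔ ∀ v : Unit ⊕ DistIdx p T → ℝ,
      (liftMatrix p T x₀ *ᵥ v) ⬝ᵥ S.regretMatrix Φ *ᵥ (liftMatrix p T x₀ *ᵥ v)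
        ≤ μ * ((liftMatrix p T x₀ *ᵥ v) ⬝ᵥ W *ᵥ (liftMatrix p T x₀ *ᵥ v))
          + ∑ i, lam i * (block v i ⬝ᵥ P *ᵥ block v i - v (Sum.inl ()) ^ 2) := by
  have hWt : Wᵀ = W := hW.1
  have hst := transpose_sqrt S.bigC
  have hss := sqrt_mul_sqrt_of_posSemidef (bigC_posSemidef hQ hR)
  set Λ := liftMatrix p T x₀
  set Y := CFC.sqrt S.bigC * Φ * Λ with hY
  have hYY : Yᵀ * Y = Λᵀ * (Φᵀ * S.bigC * Φ) * Λ := by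
    rw [← hss, hY]
    simp only [Matrix.transpose_mul, hst, Matrix.mul_assoc]
  have hsub : Λᵀ * (S.opO + μ • W) * Λ + multiplierMatrix P lam - Yᵀ * Y
      = Λᵀ * (μ • W) * Λ + multiplierMatrix P lam - Λᵀ * S.regretMatrix Φ * Λ := by
    rw [hYY, regretMatrix, Matrix.mul_sub, Matrix.sub_mul, Matrix.mul_add, Matrix.add_mul]
    abel
  have hquad : ∀ v : Unit ⊕ DistIdx p T → ℝ,
      v ⬝ᵥ (Λᵀ * (μ • W) * Λ + multiplierMatrix P lam - Λᵀ * S.regretMatrix Φ * Λ) *ᵥ v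
      = μ * ((Λ *ᵥ v) ⬝ᵥ W *ᵥ (Λ *ᵥ v))
          + ∑ i, lam i * (block v i ⬝ᵥ P *ᵥ block v i - v (Sum.inl ()) ^ 2)
        - (Λ *ᵥ v) ⬝ᵥ S.regretMatrix Φ *ᵥ (Λ *ᵥ v) := by
    intro v
    rw [Matrix.sub_mulVec, Matrix.add_mulVec, dotProduct_sub, dotProduct_add,
      dotProduct_transpose_mul_mul_mulVec, dotProduct_transpose_mul_mul_mulVec,
      dotProduct_multiplierMatrix_mulVec, Matrix.smul_mulVec, dotProduct_smul, smul_eq_mul]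
  let _ : Invertible (1 : Matrix (StateIdx n T ⊕ InputIdx m T) (StateIdx n T ⊕ InputIdx m T) ℝ) :=
    invertibleOne
  have hschur := Matrix.PosDef.fromBlocks₂₂
    (Λᵀ * (S.opO + μ • W) * Λ + multiplierMatrix P lam) Yᵀ
    (D := (1 : Matrix (StateIdx n T ⊕ InputIdx m T) (StateIdx n T ⊕ InputIdx m T) ℝ))
    Matrix.PosDef.one
  rw [Matrix.conjTranspose_eq_transpose_of_trivial, Matrix.transpose_transpose, inv_one,
    Matrix.mul_one, hsub] at hschur
  rw [lmi_eq hQ hR hW, hschur, Matrix.posSemidef_iff_dotProduct_mulVec]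
  constructor
  · rintro ⟨-, h⟩ v
    have := h v
    rw [star_trivial, hquad] at this
    linarith
  · refine fun h => ⟨?_, fun v => ?_⟩
    · have hCt : S.bigCᵀ = S.bigC := (bigC_posSemidef hQ hR).1
      have hRt : (S.regretMatrix Φ)ᵀ = S.regretMatrix Φ := by
        simp only [regretMatrix, Matrix.transpose_sub, Matrix.transpose_mul, hCt,
          Matrix.transpose_transpose, opO_transpose hQ hR, Matrix.mul_assoc]
      rw [Matrix.IsHermitian, Matrix.conjTranspose_eq_transpose_of_trivial]
      simp only [Matrix.transpose_sub, Matrix.transpose_add, Matrix.transpose_mul,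
        Matrix.transpose_smul, Matrix.transpose_transpose, hWt, hRt,
        multiplierMatrix_transpose hP, Matrix.mul_assoc]
    · rw [star_trivial, hquad]
      linarith [h v]

/-! ### Comparison of the levels -/

lemma exists_dotProduct_mulVec_eq_one {P : Matrix (Fin p) (Fin p) ℝ} (hP : P.PosDef)
    (hp : 0 < p) : ∃ e : Fin p → ℝ, e ⬝ᵥ P *ᵥ e = 1 := by
  have hne : (Pi.single ⟨0, hp⟩ 1 : Fin p → ℝ) ≠ 0 := by simp
  have h := hP.dotProduct_mulVec_pos hne
  rw [star_trivial] at h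
  set q := (Pi.single ⟨0, hp⟩ 1 : Fin p → ℝ) ⬝ᵥ P *ᵥ Pi.single ⟨0, hp⟩ 1
  refine ⟨(√q)⁻¹ • Pi.single ⟨0, hp⟩ 1, ?_⟩
  rw [Matrix.mulVec_smul, dotProduct_smul, smul_dotProduct, smul_eq_mul, smul_eq_mul]
  change (√q)⁻¹ * ((√q)⁻¹ * q) = 1
  rw [← mul_assoc, ← mul_inv, Real.mul_self_sqrt h.le, inv_mul_cancel₀ h.ne']

/-- A disturbance on the boundary of all ellipsoids at once. The multipliers do not contribute
there, so that it bounds the levels of both problems from below. -/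
lemma exists_boundary_disturbance {P : Matrix (Fin p) (Fin p) ℝ} (hP : P.PosDef) (hp : 0 < p)
    (hT : 0 < T) {W : Matrix (DeltaIdx n p T) (DeltaIdx n p T) ℝ} (hW : W.PosDef)
    (x₀ : Fin n → ℝ) : ∃ w : DistIdx p T → ℝ,
      (∀ k, (fun b => w (b, k)) ⬝ᵥ P *ᵥ (fun b => w (b, k)) = 1) ∧
      0 < delta x₀ w ⬝ᵥ W *ᵥ delta x₀ w := by
  obtain ⟨e, he⟩ := exists_dotProduct_mulVec_eq_one hP hp
  refine ⟨fun c => e c.1, fun _ => he, ?_⟩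
  have hne : delta x₀ (fun c : DistIdx p T => e c.1) ≠ 0 := by
    intro h
    have h0 : e = 0 := funext fun b => congr_fun h (Sum.inr (b, ⟨0, hT⟩))
    simp [h0] at he
  simpa using hW.dotProduct_mulVec_pos hne

lemma nonneg_of_mem_responseLevels (hQ : ∀ k, (S.Q k).PosSemidef) (hR : ∀ k, (S.R k).PosDef)
    {W : Matrix (DeltaIdx n p T) (DeltaIdx n p T) ℝ} (hW : W.PosDef)
    {P : Matrix (Fin p) (Fin p) ℝ} (hP : P.PosDef) (hp : 0 < p) (hT : 0 < T) {x₀ : Fin n → ℝ}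
    {μ : ℝ} (hμ : μ ∈ S.responseLevels W P x₀) : 0 ≤ μ := by
  obtain ⟨Φ, hΦ, h⟩ := hμ
  obtain ⟨w, hw, hpos⟩ := exists_boundary_disturbance hP hp hT hW x₀
  have h1 := h w fun k => (hw k).le
  rw [hΦ.regret_eq hQ hR] at h1
  have h2 := (hΦ.regretMatrix_posSemidef hQ hR).dotProduct_mulVec_nonneg (delta x₀ w)
  rw [star_trivial] at h2
  exact nonneg_of_mul_nonneg_left (h2.trans h1) hpos

lemma nonneg_of_mem_sdpLevels (hQ : ∀ k, (S.Q k).PosSemidef) (hR : ∀ k, (S.R k).PosDef)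
    {W : Matrix (DeltaIdx n p T) (DeltaIdx n p T) ℝ} (hW : W.PosDef)
    {P : Matrix (Fin p) (Fin p) ℝ} (hP : P.PosDef) (hp : 0 < p) (hT : 0 < T) {x₀ : Fin n → ℝ}
    {μ : ℝ} (hμ : μ ∈ S.sdpLevels W P x₀) : 0 ≤ μ := by
  obtain ⟨lam, Φ, -, hΦ, h⟩ := hμ
  obtain ⟨w, hw, hpos⟩ := exists_boundary_disturbance hP hp hT hW x₀
  have h1 := (lmi_posSemidef_iff hQ hR hW hP x₀ μ lam Φ).1 h (Sum.elim (fun _ => 1) w)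
  have h3 : liftMatrix p T x₀ *ᵥ Sum.elim (fun _ => 1) w = delta x₀ w := by
    rw [liftMatrix_mulVec]; simp
  have h4 : ∀ i, block (Sum.elim (fun _ => 1) w) i ⬝ᵥ P *ᵥ block (Sum.elim (fun _ => 1) w) i = 1 :=
    hw
  rw [h3] at h1
  simp only [h4, Sum.elim_inl, one_pow, sub_self, mul_zero, Finset.sum_const_zero, add_zero] at h1
  have h2 := (hΦ.regretMatrix_posSemidef hQ hR).dotProduct_mulVec_nonneg (delta x₀ w)
  rw [star_trivial] at h2
  exact nonneg_of_mul_nonneg_left (h2.trans h1) hpos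

/-- The regret bound on `δ = (x₀, w)` with `w` in the product of ellipsoids, in homogeneous form. -/
lemma HasRegretLevel.dotProduct_le (hQ : ∀ k, (S.Q k).PosSemidef) (hR : ∀ k, (S.R k).PosDef)
    {W : Matrix (DeltaIdx n p T) (DeltaIdx n p T) ℝ}
    {P : Matrix (Fin p) (Fin p) ℝ} (hP : P.PosDef) {x₀ : Fin n → ℝ}
    {Φ : Matrix (StateIdx n T ⊕ InputIdx m T) (DeltaIdx n p T) ℝ} (hΦ : S.IsResponse Φ) {μ : ℝ}
    (h : S.HasRegretLevel W P x₀ Φ.toRows₂ μ) (v : Unit ⊕ DistIdx p T → ℝ)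
    (hv : ∀ i, block v i ⬝ᵥ P *ᵥ block v i ≤ v (Sum.inl ()) ^ 2) :
    (liftMatrix p T x₀ *ᵥ v) ⬝ᵥ S.regretMatrix Φ *ᵥ (liftMatrix p T x₀ *ᵥ v)
      ≤ μ * ((liftMatrix p T x₀ *ᵥ v) ⬝ᵥ W *ᵥ (liftMatrix p T x₀ *ᵥ v)) := by
  set t := v (Sum.inl ()) with ht
  rcases eq_or_ne t 0 with h0 | h0
  · -- The constraints force `w = 0`, so that `v = 0`.
    have hv0 : v = 0 := by
      ext (a | ⟨b, i⟩)
      · exact h0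
      · by_contra hne
        have hb : block v i ≠ 0 := fun hb => hne (congr_fun hb b)
        have h1 := hP.dotProduct_mulVec_pos hb
        have h2 := hv i
        rw [star_trivial] at h1
        rw [h0] at h2
        norm_num at h2
        linarith
    simp [hv0]
  · set w : DistIdx p T → ℝ := fun c => t⁻¹ * v (Sum.inr c) with hw
    have hlift : liftMatrix p T x₀ *ᵥ v = t • delta x₀ w := by
      rw [liftMatrix_mulVec]
      ext (a | c)
      · simp [delta, ht]
      · simp [delta, hw, h0]
    have hmem : w ∈ pointwiseBounded P T := by
      intro k
      have h1 : (fun b => w (b, k)) = t⁻¹ • block v k := rfl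
      change (fun b => w (b, k)) ⬝ᵥ P *ᵥ (fun b => w (b, k)) ≤ 1
      rw [h1, Matrix.mulVec_smul, dotProduct_smul, smul_dotProduct, smul_eq_mul, smul_eq_mul]
      have h2 := hv k
      have h3 : 0 < t ^ 2 := by positivity
      rw [← mul_assoc, ← mul_inv, ← sq, inv_mul_le_iff₀ h3, mul_one]
      exact h2
    have h1 := h w hmem
    rw [hΦ.regret_eq hQ hR] at h1
    rw [hlift]
    simp only [Matrix.mulVec_smul, dotProduct_smul, smul_dotProduct, smul_eq_mul]
    have h3 : 0 ≤ t * t := mul_self_nonneg t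
    have h4 := mul_le_mul_of_nonneg_left h1 h3
    linarith

/-- Any level that a system response achieves on pointwise bounded disturbances is feasible for the
semidefinite program, with the same response, after multiplication by `(π / 2) κ(W)`. -/
theorem mul_mem_sdpLevels [Nonempty (DeltaIdx n p T)] (hQ : ∀ k, (S.Q k).PosSemidef)
    (hR : ∀ k, (S.R k).PosDef)
    {W : Matrix (DeltaIdx n p T) (DeltaIdx n p T) ℝ} (hW : W.PosDef)
    {P : Matrix (Fin p) (Fin p) ℝ} (hP : P.PosDef) (hp : 0 < p) (hT : 0 < T) {x₀ : Fin n → ℝ}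
    {μ : ℝ} (hμ : μ ∈ S.responseLevels W P x₀) :
    Real.pi / 2 * condNumber W * μ ∈ S.sdpLevels W P x₀ := by
  have hμ0 := nonneg_of_mem_responseLevels hQ hR hW hP hp hT hμ
  obtain ⟨Φ, hΦ, h⟩ := hμ
  set Λ := liftMatrix p T x₀
  have hM : (Λᵀ * S.regretMatrix Φ * Λ).PosSemidef := by
    have := (hΦ.regretMatrix_posSemidef hQ hR).conjTranspose_mul_mul_same Λ
    rwa [Matrix.conjTranspose_eq_transpose_of_trivial] at this
  obtain ⟨lam, hlam, hbound⟩ := exists_multipliers_of_bound (N := Λᵀ * W * Λ)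
    (D := Sum.elim (fun _ => ∑ b, x₀ b ^ 2) fun _ => 1) hP hM
    (PosDef.singularValues_pos hW) ((Matrix.toEuclideanLin W).singularValues_nonneg 0) hμ0
    (fun v => by
      rw [← sum_liftMatrix_mulVec_sq, dotProduct_transpose_mul_mul_mulVec]
      exact PosDef.singularValue_mul_le_dotProduct hW _)
    (fun v => by
      rw [← sum_liftMatrix_mulVec_sq, dotProduct_transpose_mul_mul_mulVec]
      exact PosDef.dotProduct_le_singularValue_mul hW _)
    (fun v hv => by
      rw [dotProduct_transpose_mul_mul_mulVec, dotProduct_transpose_mul_mul_mulVec]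
      exact h.dotProduct_le hQ hR hP hΦ v hv)
  refine ⟨lam, Φ, hlam, hΦ, (lmi_posSemidef_iff hQ hR hW hP x₀ _ lam Φ).2 fun v => ?_⟩
  have := hbound v
  rwa [dotProduct_transpose_mul_mul_mulVec, dotProduct_transpose_mul_mul_mulVec] at this

/-- The open loop `K = 0` has a finite regret level, because its regret is a quadratic form. -/
lemma feedbackLevels_nonempty [Nonempty (DeltaIdx n p T)] (hQ : ∀ k, (S.Q k).PosSemidef)
    (hR : ∀ k, (S.R k).PosDef)
    {W : Matrix (DeltaIdx n p T) (DeltaIdx n p T) ℝ} (hW : W.PosDef)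
    (P : Matrix (Fin p) (Fin p) ℝ) (x₀ : Fin n → ℝ) : (S.feedbackLevels W P x₀).Nonempty := by
  have hK : CausalGain (0 : Matrix (InputIdx m T) (StateIdx n T) ℝ) := fun _ _ _ _ _ => rfl
  obtain ⟨Φ, hΦ, hu⟩ := exists_isResponse_of_causalGain (S := S) hK
  -- The identity is added to obtain a positive definite upper bound of the regret matrix.
  have hM := Matrix.PosDef.posSemidef_add (hΦ.regretMatrix_posSemidef hQ hR)
    (Matrix.PosDef.one (n := DeltaIdx n p T) (R := ℝ))
  set c := (Matrix.toEuclideanLin (S.regretMatrix Φ + 1)).singularValues 0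
  set s := (Matrix.toEuclideanLin W).singularValues (Fintype.card (DeltaIdx n p T) - 1)
  have hs0 : 0 < s := PosDef.singularValues_pos hW
  refine ⟨c / s, 0, hK, fun w _ => ?_⟩
  rw [← hu, hΦ.regret_eq hQ hR]
  set δ := delta x₀ w
  have h1 := PosDef.dotProduct_le_singularValue_mul hM δ
  have h2 := PosDef.singularValue_mul_le_dotProduct hW δ
  rw [Matrix.add_mulVec, dotProduct_add, Matrix.one_mulVec] at h1
  have h3 : 0 ≤ δ ⬝ᵥ δ := by simpa using dotProduct_star_self_nonneg δ
  have h4 : 0 ≤ c / s := div_nonneg (LinearMap.singularValues_nonneg _ _) hs0.le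
  calc δ ⬝ᵥ S.regretMatrix Φ *ᵥ δ ≤ c * ∑ a, δ a ^ 2 := by linarith
    _ = c / s * (s * ∑ a, δ a ^ 2) := by field_simp
    _ ≤ c / s * (δ ⬝ᵥ W *ᵥ δ) := mul_le_mul_of_nonneg_left h2 h4

end LTVSystem

end

end GenRegret

theorem proposition2 {n m p T : ℕ} (hn : 0 < n) (hT : 0 < T)
    (S : GenRegret.LTVSystem n m p T)
    (hE : ∀ k, (S.E k).rank = n)
    (hQ : ∀ k, (S.Q k).PosSemidef)
    (hR : ∀ k, (S.R k).PosDef)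
    (W : Matrix (GenRegret.DeltaIdx n p T) (GenRegret.DeltaIdx n p T) ℝ) (hW : W.PosDef)
    (P : Matrix (Fin p) (Fin p) ℝ) (hP : P.PosDef)
    (x₀ : Fin n → ℝ) :
    ((S.sdpLevels W P x₀).Nonempty ∧ BddBelow (S.sdpLevels W P x₀)) ∧
    ((S.feedbackLevels W P x₀).Nonempty ∧ BddBelow (S.feedbackLevels W P x₀)) ∧
    ((S.responseLevels W P x₀).Nonempty ∧ BddBelow (S.responseLevels W P x₀)) ∧
    2 / (Real.pi * GenRegret.condNumber W) * sInf (S.sdpLevels W P x₀)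
      ≤ sInf (S.feedbackLevels W P x₀) ∧
    2 / (Real.pi * GenRegret.condNumber W) * sInf (S.sdpLevels W P x₀)
      ≤ sInf (S.responseLevels W P x₀) := by
  -- Full row rank forces `p > 0`, so that there are nonzero disturbances.
  have hp : 0 < p := by
    have h := (S.E ⟨0, hT⟩).rank_le_width
    rw [hE] at h
    omega
  have : Nonempty (GenRegret.DeltaIdx n p T) := ⟨Sum.inl ⟨0, hn⟩⟩
  have hfb := GenRegret.LTVSystem.feedbackLevels_nonempty (S := S) hQ hR hW P x₀
  have hsub := GenRegret.LTVSystem.feedbackLevels_subset_responseLevels (S := S) W P x₀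
  have hresp := hfb.mono hsub
  have hbresp : BddBelow (S.responseLevels W P x₀) :=
    ⟨0, fun _ h => GenRegret.LTVSystem.nonneg_of_mem_responseLevels hQ hR hW hP hp hT h⟩
  have hbsdp : BddBelow (S.sdpLevels W P x₀) :=
    ⟨0, fun _ h => GenRegret.LTVSystem.nonneg_of_mem_sdpLevels hQ hR hW hP hp hT h⟩
  have hmem := fun μ (hμ : μ ∈ S.responseLevels W P x₀) =>
    GenRegret.LTVSystem.mul_mem_sdpLevels hQ hR hW hP hp hT hμ
  have hκ := GenRegret.condNumber_pos hW
  have hle : 2 / (Real.pi * GenRegret.condNumber W) * sInf (S.sdpLevels W P x₀)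
      ≤ sInf (S.responseLevels W P x₀) := by
    refine le_csInf hresp fun μ hμ => ?_
    have h1 := csInf_le hbsdp (hmem μ hμ)
    have hpi := Real.pi_pos
    rw [div_mul_eq_mul_div, div_le_iff₀ (by positivity)]
    linarith
  exact ⟨⟨⟨_, hmem _ hresp.some_mem⟩, hbsdp⟩, ⟨hfb, hbresp.mono hsub⟩,
    ⟨hresp, hbresp⟩, hle.trans (csInf_le_csInf hbresp hfb hsub), hle⟩
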